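/- Let $\mathbb{B}=\{0,1\}$, let $\log$ be the logarithm in base $2$ with $0\log 0=0$, and for $x\in\mathbb{B}^{\mathbb{N}}$ let $x[0{:}n)$ be its prefix of length $n$. For a finite word $w$ and $\ell\ge 1$ with $\ell<|w|$ put $$\beta_\ell(w)=\tfrac{1}{|w|-\ell}\min_{f:\mathbb{B}^\ell\to\mathbb{B}}\#\{0\le i<|w|-\ell : w[i]\ne f(w[i+1]\cdots w[i+\ell])\},$$ $$\gamma_\ell(w)=\tfrac{1}{|w|-\ell}\min_{f:\mathbb{B}^\ell\to\mathbb{B}}\#\{\ell\le i<|w| : w[i]\ne f(w[i-\ell]\cdots w[i-1])\},$$ $$h_\ell(w)=-\tfrac1\ell\sum_{u\in\mathbb{B}^\ell} f_u\log f_u,\qquad f_u=\tfrac{\mathrm{occ}(w,u)}{|w|-\ell+1},$$ where $\mathrm{occ}(w,u)$ is the number of (possibly overlapping) occurrences of $u$ in $w$. For $\varphi\in\{\beta,\gamma,h\}$ put $\underline{\varphi}_\ell(x)=\liminf_{n\to\infty}\varphi_\ell(x[0{:}n))$, $\overline{\varphi}_\ell(x)=\limsup_{n\to\infty}\varphi_\ell(x[0{:}n))$,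 $\underline\varphi(x)=\lim_{\ell\to\infty}\underline\varphi_\ell(x)$ and $\overline\varphi(x)=\lim_{\ell\to\infty}\overline\varphi_\ell(x)$. Let $H(\alpha)=-\alpha\log\alpha-(1-\alpha)\log(1-\alpha)$ for $\alpha\in[0,1]$. A sequence is called generic for the Bernoulli measure $\mu$ with $\mu(0)=\alpha$, $\mu(1)=1-\alpha$ if for every finite word $u$ the quotient $\mathrm{occ}(x[0{:}n),u)/n$ tends to the $\mu$-measure of the cylinder of $u$; it is normal if this holds with $\alpha=1/2$. **Theorem 1.** 1. For every $x\in\mathbb{B}^{\mathbb{N}}$ the six limits $\underline\gamma(x),\overline\gamma(x),\underline\beta(x),\overline\beta(x),\underline h(x),\overline h(x)$ exist, and $$2\underline\gamma(x)\le\underline h(x)\le H(\underline\gamma(x)),\qquad 2\overline\gamma(x)\le\overline h(x)\le H(\overline\gamma(x)),$$ $$2\underline\beta(x)\le\underline h(x)\le H(\underline\beta(x)),\qquad 2\overline\beta(x)\le\overline h(x)\le H(\overline\beta(x)).$$ 2. These bounds are sharp. Let $0\le\alpha\le 1/2$. * There are sequences that are generic for the Bernoulli measure $\mu$ with $\mu(0)=\alpha$,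 $\mu(1)=1-\alpha$, and each such sequence $x'$ satisfies $\underline\gamma(x')=\overline\gamma(x')=\underline\beta(x')=\overline\beta(x')=\alpha$ and $\underline h(x')=\overline h(x')=H(\alpha)$. * For every $\varepsilon>0$ there are integers $0\le p<q$, a real $\alpha'\in[0,1/2]$ with $\alpha=\frac{p}{2q}+\frac{\alpha'}{q}$, a normal sequence $y$ and a sequence $z$ that is generic for the Bernoulli measure $\mu'$ with $\mu'(0)=\alpha'$, $\mu'(1)=1-\alpha'$, such that the sequence $x$ given by $x_n=y_n$ if $n\bmod q<p$, $x_n=z_n$ if $n\bmod q=p$, and $x_n=0$ otherwise, satisfies $\underline\gamma(x)=\overline\gamma(x)=\underline\beta(x)=\overline\beta(x)=\alpha$ and $\underline h(x)=\overline h(x)=\frac pq+\frac{H(\alpha')}{q}\le 2\alpha+\varepsilon$. -/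

import Mathlib

open Filter Topology

namespace RauzyEntropy

/-- Infinite binary sequences; `false` is the symbol 0 and `true` is the symbol 1. -/
abbrev BinSeq : Type := ℕ → Bool

/-- Finite binary words of length `n`. -/
abbrev Word (n : ℕ) : Type := Fin n → Bool

/-- The prefix `x[0:n)`. -/
def pre (x : BinSeq) (n : ℕ) : Word n := fun i => x i

/-- The number of mismatches between a symbol of `w` and the symbol that `f` predicts from the
`l` symbols after it. -/
def betaErrors (l : ℕ) {n : ℕ} (w : Word n) (f : Word l → Bool) : ℕ :=
  (Finset.univ.filter fun i : Fin (n - l) =>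
    w ⟨i, by omega⟩ ≠ f (fun j : Fin l => w ⟨i + 1 + j, by omega⟩)).card

/-- The number of mismatches between a symbol of `w` and the symbol that `f` predicts from the
`l` symbols before it; the predicted position is `i + l`. -/
def gammaErrors (l : ℕ) {n : ℕ} (w : Word n) (f : Word l → Bool) : ℕ :=
  (Finset.univ.filter fun i : Fin (n - l) =>
    w ⟨i + l, by omega⟩ ≠ f (fun j : Fin l => w ⟨i + j, by omega⟩)).card

/-- The Rauzy function `β_l` on finite words. -/
noncomputable def betaWord (l : ℕ) {n : ℕ} (w : Word n) : ℝ :=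
  (Finset.univ.inf' Finset.univ_nonempty (betaErrors l w) : ℕ) / ((n : ℝ) - l)

/-- The Rauzy function `γ_l` on finite words. -/
noncomputable def gammaWord (l : ℕ) {n : ℕ} (w : Word n) : ℝ :=
  (Finset.univ.inf' Finset.univ_nonempty (gammaErrors l w) : ℕ) / ((n : ℝ) - l)

/-- The number of (possibly overlapping) occurrences of `u` in `w`. -/
def occ {n l : ℕ} (w : Word n) (u : Word l) : ℕ :=
  (Finset.univ.filter fun i : Fin (n + 1 - l) =>
    ∀ j : Fin l, w ⟨i + j, by omega⟩ = u j).card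

/-- The frequency of `u` among the factors of `w` of the same length. -/
noncomputable def freq {n l : ℕ} (w : Word n) (u : Word l) : ℝ :=
  (occ w u : ℝ) / ((n : ℝ) - l + 1)

/-- The non-aligned `l`-block entropy of a finite word. -/
noncomputable def blockEntropyWord (l : ℕ) {n : ℕ} (w : Word n) : ℝ :=
  -(1 / (l : ℝ)) * ∑ u : Word l, freq w u * Real.logb 2 (freq w u)

noncomputable def betaLowerAt (l : ℕ) (x : BinSeq) : ℝ :=
  liminf (fun n : ℕ => betaWord l (pre x n)) atTop

noncomputable def betaUpperAt (l : ℕ) (x : BinSeq) : ℝ :=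
  limsup (fun n : ℕ => betaWord l (pre x n)) atTop

noncomputable def gammaLowerAt (l : ℕ) (x : BinSeq) : ℝ :=
  liminf (fun n : ℕ => gammaWord l (pre x n)) atTop

noncomputable def gammaUpperAt (l : ℕ) (x : BinSeq) : ℝ :=
  limsup (fun n : ℕ => gammaWord l (pre x n)) atTop

noncomputable def hLowerAt (l : ℕ) (x : BinSeq) : ℝ :=
  liminf (fun n : ℕ => blockEntropyWord l (pre x n)) atTop

noncomputable def hUpperAt (l : ℕ) (x : BinSeq) : ℝ :=
  limsup (fun n : ℕ => blockEntropyWord l (pre x n)) atTop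

/-- The limit of `betaLowerAt l x` as `l` tends to infinity. -/
noncomputable def betaLower (x : BinSeq) : ℝ := limUnder atTop (fun l : ℕ => betaLowerAt l x)

/-- The limit of `betaUpperAt l x` as `l` tends to infinity. -/
noncomputable def betaUpper (x : BinSeq) : ℝ := limUnder atTop (fun l : ℕ => betaUpperAt l x)

/-- The limit of `gammaLowerAt l x` as `l` tends to infinity. -/
noncomputable def gammaLower (x : BinSeq) : ℝ := limUnder atTop (fun l : ℕ => gammaLowerAt l x)

/-- The limit of `gammaUpperAt l x` as `l` tends to infinity. -/
noncomputable def gammaUpper (x : BinSeq) : ℝ := limUnder atTop (fun l : ℕ => gammaUpperAt l x)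

/-- The lower non-aligned block entropy. -/
noncomputable def hLower (x : BinSeq) : ℝ := limUnder atTop (fun l : ℕ => hLowerAt l x)

/-- The upper non-aligned block entropy. -/
noncomputable def hUpper (x : BinSeq) : ℝ := limUnder atTop (fun l : ℕ => hUpperAt l x)

/-- The Shannon entropy (in bits) of a Bernoulli variable of parameter `a`. -/
noncomputable def shannonH (a : ℝ) : ℝ :=
  -a * Real.logb 2 a - (1 - a) * Real.logb 2 (1 - a)

/-- `x` is generic for the Bernoulli measure that gives the symbol 0 probability `a` and the
symbol 1 probability `1 - a`: each word occurs with the frequency that the measure gives to its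
cylinder. -/
def BernoulliGeneric (a : ℝ) (x : BinSeq) : Prop :=
  ∀ (l : ℕ) (u : Word l),
    Tendsto (fun n : ℕ => (occ (pre x n) u : ℝ) / n) atTop
      (𝓝 (∏ j : Fin l, if u j = false then a else 1 - a))

/-- Borel normality in base 2: each word of length `l` occurs with frequency `2 ^ (-l)`. -/
def BorelNormal (x : BinSeq) : Prop :=
  ∀ (l : ℕ) (u : Word l),
    Tendsto (fun n : ℕ => (occ (pre x n) u : ℝ) / n) atTop (𝓝 ((1 / 2 : ℝ) ^ l))

/-- The periodic interleaving, with period `q`, of `y` (residues below `p`), `z` (residue `p`) and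
zeros (the other residues). -/
def interleave (p q : ℕ) (y z : BinSeq) : BinSeq := fun n =>
  if n % q < p then y n else if n % q = p then z n else false

end RauzyEntropy

open RauzyEntropy

/-! Read cyclically, a finite prefix has word frequencies that are the cylinder measures of a
shift-invariant probability measure `P`, and they differ from the true frequencies by at most `l /
(n + 1)`. So every inequality may be proved for `Stationary` weights and carried over to prefixes
with an error that vanishes as `n → ∞`. For such `P` the best predictor decides separately in each
context `v` and errs on the rarer extension, so the error is `∑ v, min (P (v0)) (P (v1))`. The
entropy of words grows from length `l` to `l + 1` by the conditional entropy of a symbol given the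
preceding `l`, which is `∑ v, splitEntropy (P (v0)) (P (v1))`. Concavity of the binary entropy gives
everything: its chord on `[0, 1/2]` bounds each term below by `2 log 2` times the minimum, Jensen
bounds the sum above by the binary entropy of the error, and superadditivity of both summands makes
both sums decrease in `l`. Averaging the increments compares them with the block entropy. Reversal
preserves the entropy and exchanges `γ` with `β`. Since `liminf` and `limsup` are both monotone and
commute with continuous monotone maps, one argument (`LimitLike.entropy_bounds`) serves both. For
sharpness, consider independent symbols whose law depends on the position modulo `q`, averaged over
the phase. If in each phase the symbol 0 has probability at most `1/2` or equal to `1`, the past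
eventually reveals which kind of phase comes next, so the error tends to the average of `min θ (1 -
θ)`. Not knowing the phase changes the entropy of a word by at most `log q`, so the rate tends to
the average of `H θ`. One phase gives the upper bounds. Phases with `θ` equal to `1/2` or `1`, where
`H θ = 2 min θ (1 - θ)`, give the lower ones, and a single correcting phase adjusts the mean. The
strong law of large numbers supplies the sequences. -/

namespace RauzyEntropy

/-! ### Words and shift-invariant weights -/

/-- The word `v` followed by the symbol `c`. -/
abbrev snocWord {l : ℕ} (v : Word l) (c : Bool) : Word (l + 1) := Fin.snoc (α := fun _ => Bool) v c

/-- The word `v` preceded by the symbol `c`. -/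
abbrev consWord {l : ℕ} (c : Bool) (v : Word l) : Word (l + 1) := Fin.cons (α := fun _ => Bool) c v

theorem sum_word_snoc {M : Type*} [AddCommMonoid M] {l : ℕ} (F : Word (l + 1) → M) :
    ∑ u, F u = ∑ v : Word l, (F (snocWord v false) + F (snocWord v true)) := by
  rw [← Equiv.sum_comp (Fin.snocEquiv fun _ => Bool), Fintype.sum_prod_type_right]
  refine Finset.sum_congr rfl fun v _ => ?_
  rw [Fintype.sum_bool, add_comm]
  rfl

theorem sum_word_cons {M : Type*} [AddCommMonoid M] {l : ℕ} (F : Word (l + 1) → M) :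
    ∑ u, F u = ∑ v : Word l, (F (consWord false v) + F (consWord true v)) := by
  rw [← Equiv.sum_comp (Fin.consEquiv fun _ => Bool), Fintype.sum_prod_type_right]
  refine Finset.sum_congr rfl fun v _ => ?_
  rw [Fintype.sum_bool, add_comm]
  rfl

theorem consWord_snocWord {l : ℕ} (c d : Bool) (v : Word l) :
    consWord c (snocWord v d) = snocWord (consWord c v) d :=
  Fin.cons_snoc_eq_snoc_cons c v d

/-- An assignment of a real number to each finite word. -/
abbrev WordWeight : Type := ∀ l : ℕ, Word l → ℝ

/-- The word weights that are the cylinder measures of a shift-invariant probability measure. -/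
structure Stationary (P : WordWeight) : Prop where
  nonneg : ∀ l u, 0 ≤ P l u
  empty : ∀ u, P 0 u = 1
  snoc : ∀ l (v : Word l), P (l + 1) (snocWord v false) + P (l + 1) (snocWord v true) = P l v
  cons : ∀ l (v : Word l), P (l + 1) (consWord false v) + P (l + 1) (consWord true v) = P l v

/-- The sum of `F` over the pairs of weights of the two right extensions of a word. -/
noncomputable def contextSum (F : ℝ → ℝ → ℝ) (P : WordWeight) (l : ℕ) : ℝ :=
  ∑ v : Word l, F (P (l + 1) (snocWord v false)) (P (l + 1) (snocWord v true))

/-- The error of the best prediction of a symbol from the `l` symbols before it. -/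
noncomputable def predictionError (P : WordWeight) (l : ℕ) : ℝ := contextSum min P l

/-- The Shannon entropy, in nats, of the words of length `l`. -/
noncomputable def wordEntropy (P : WordWeight) (l : ℕ) : ℝ :=
  ∑ u : Word l, Real.negMulLog (P l u)

/-- The word weights of the reversed process. -/
def reversal (P : WordWeight) : WordWeight := fun l u => P l (u ∘ Fin.rev)

/-! ### Entropy of splitting a mass in two -/

/-- The entropy created by splitting the mass `s + t` into `s` and `t`. -/
noncomputable def splitEntropy (s t : ℝ) : ℝ :=
  Real.negMulLog s + Real.negMulLog t - Real.negMulLog (s + t)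

theorem splitEntropy_eq {s t : ℝ} (hs : 0 ≤ s) (ht : 0 ≤ t) :
    splitEntropy s t = (s + t) * Real.binEntropy (s / (s + t)) := by
  rcases (add_nonneg hs ht).eq_or_lt with h | h
  · have h1 : s = 0 := by linarith
    have h2 : t = 0 := by linarith
    simp [splitEntropy, h1, h2]
  · have e1 : s = (s + t) * (s / (s + t)) := by field_simp
    have e2 : t = (s + t) * (1 - s / (s + t)) := by field_simp; ring
    have h1 := Real.negMulLog_mul (s + t) (s / (s + t))
    have h2 := Real.negMulLog_mul (s + t) (1 - s / (s + t))
    rw [← e1] at h1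
    rw [← e2] at h2
    rw [splitEntropy, h1, h2, Real.binEntropy_eq_negMulLog_add_negMulLog_one_sub]
    ring

theorem splitEntropy_comm (s t : ℝ) : splitEntropy s t = splitEntropy t s := by
  simp only [splitEntropy, add_comm]

theorem splitEntropy_eq_min {s t : ℝ} (hs : 0 ≤ s) (ht : 0 ≤ t) :
    splitEntropy s t = (s + t) * Real.binEntropy (min s t / (s + t)) := by
  rcases le_total s t with h | h
  · rw [min_eq_left h, splitEntropy_eq hs ht]
  · rw [min_eq_right h, splitEntropy_comm, splitEntropy_eq ht hs, add_comm]

theorem binEntropy_concave {x y a b : ℝ} (hx : x ∈ Set.Icc (0 : ℝ) 1) (hy : y ∈ Set.Icc (0 : ℝ) 1)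
    (ha : 0 ≤ a) (hb : 0 ≤ b) (hab : a + b = 1) :
    a * Real.binEntropy x + b * Real.binEntropy y ≤ Real.binEntropy (a * x + b * y) :=
  Real.strictConcave_binEntropy.concaveOn.2 hx hy ha hb hab

/-- `(s + t) * binEntropy (s / (s + t))` is the perspective of a concave function, hence
superadditive: forgetting which of two contexts occurred cannot lower the conditional entropy. -/
theorem splitEntropy_add_le {s t s' t' : ℝ} (hs : 0 ≤ s) (ht : 0 ≤ t) (hs' : 0 ≤ s')
    (ht' : 0 ≤ t') :
    splitEntropy s t + splitEntropy s' t' ≤ splitEntropy (s + s') (t + t') := by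
  rcases (add_nonneg hs ht).eq_or_lt with h | h
  · have h1 : s = 0 := by linarith
    have h2 : t = 0 := by linarith
    simp [splitEntropy, h1, h2]
  rcases (add_nonneg hs' ht').eq_or_lt with h' | h'
  · have h1 : s' = 0 := by linarith
    have h2 : t' = 0 := by linarith
    simp [splitEntropy, h1, h2]
  rw [splitEntropy_eq hs ht, splitEntropy_eq hs' ht',
    splitEntropy_eq (add_nonneg hs hs') (add_nonneg ht ht')]
  have hW : 0 < s + t + (s' + t') := by positivity
  have hmem : ∀ {a b : ℝ}, 0 ≤ a → 0 ≤ b → 0 < a + b → a / (a + b) ∈ Set.Icc (0 : ℝ) 1 := by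
    intro a b ha hb hab
    exact ⟨by positivity, (div_le_one hab).2 (by linarith)⟩
  have key := binEntropy_concave (hmem hs ht h) (hmem hs' ht' h')
    (a := (s + t) / (s + t + (s' + t'))) (b := (s' + t') / (s + t + (s' + t')))
    (by positivity) (by positivity) (by field_simp)
  have e : ((s + t) / (s + t + (s' + t'))) * (s / (s + t)) +
      ((s' + t') / (s + t + (s' + t'))) * (s' / (s' + t')) = (s + s') / (s + s' + (t + t')) := by
    have : s + s' + (t + t') = s + t + (s' + t') := by ring
    rw [this]
    field_simp
  rw [e] at key
  have : s + s' + (t + t') = s + t + (s' + t') := by ring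
  rw [this] at key ⊢
  have := mul_le_mul_of_nonneg_left key hW.le
  refine le_trans (le_of_eq ?_) this
  field_simp

theorem min_add_min_le (s t s' t' : ℝ) : min s t + min s' t' ≤ min (s + s') (t + t') :=
  le_min (add_le_add (min_le_left _ _) (min_le_left _ _))
    (add_le_add (min_le_right _ _) (min_le_right _ _))

/-- A concave function lies above its chord, here the one from `0` to `1/2`. -/
theorem two_log_two_mul_le_binEntropy {p : ℝ} (h0 : 0 ≤ p) (h1 : p ≤ 1 / 2) :
    2 * Real.log 2 * p ≤ Real.binEntropy p := by
  have key := binEntropy_concave (x := 0) (y := 2⁻¹) (by simp)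
    (by constructor <;> norm_num)
    (a := 1 - 2 * p) (b := 2 * p) (by linarith) (by linarith) (by ring)
  have e : (1 - 2 * p) * (0 : ℝ) + (2 * p) * (2⁻¹ : ℝ) = p := by ring
  rw [e] at key
  simp only [Real.binEntropy_zero, Real.binEntropy_two_inv] at key
  linarith

theorem two_log_two_mul_min_le_splitEntropy {s t : ℝ} (hs : 0 ≤ s) (ht : 0 ≤ t) :
    2 * Real.log 2 * min s t ≤ splitEntropy s t := by
  rw [splitEntropy_eq_min hs ht]
  rcases (add_nonneg hs ht).eq_or_lt with h | h
  · have h1 : s = 0 := by linarith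
    have h2 : t = 0 := by linarith
    simp [h1, h2]
  · have hle : min s t ≤ (s + t) / 2 := by
      have := min_le_left s t
      have := min_le_right s t
      linarith
    have := mul_le_mul_of_nonneg_left (two_log_two_mul_le_binEntropy
      (p := min s t / (s + t)) (div_nonneg (le_min hs ht) h.le)
      (by rw [div_le_iff₀ h]; linarith)) h.le
    refine le_trans (le_of_eq ?_) this
    field_simp

/-! ### Prediction error and conditional entropy of a stationary process -/

/-- By shift invariance the contexts `0v` and `1v` merge into `v`, and a superadditive `F` can only
gain from the merging. It is applied to `min` and to `splitEntropy`. -/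
theorem Stationary.contextSum_succ_le {P : WordWeight} (hP : Stationary P) {F : ℝ → ℝ → ℝ}
    (hF : ∀ s t s' t', 0 ≤ s → 0 ≤ t → 0 ≤ s' → 0 ≤ t' → F s t + F s' t' ≤ F (s + s') (t + t'))
    (l : ℕ) : contextSum F P (l + 1) ≤ contextSum F P l := by
  rw [contextSum, sum_word_cons]
  refine Finset.sum_le_sum fun v _ => ?_
  rw [← hP.cons _ (snocWord v false), ← hP.cons _ (snocWord v true)]
  simp only [consWord_snocWord]
  exact hF _ _ _ _ (hP.nonneg _ _) (hP.nonneg _ _) (hP.nonneg _ _) (hP.nonneg _ _)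

theorem Stationary.sum_eq_one {P : WordWeight} (hP : Stationary P) (l : ℕ) : ∑ u, P l u = 1 := by
  induction l with
  | zero => simp [hP.empty]
  | succ l ih =>
    rw [sum_word_snoc, ← ih]
    exact Finset.sum_congr rfl fun v _ => hP.snoc l v

theorem Stationary.predictionError_succ_le {P : WordWeight} (hP : Stationary P) (l : ℕ) :
    predictionError P (l + 1) ≤ predictionError P l :=
  hP.contextSum_succ_le (fun s t s' t' _ _ _ _ => min_add_min_le s t s' t') l

theorem Stationary.predictionError_nonneg {P : WordWeight} (hP : Stationary P) (l : ℕ) :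
    0 ≤ predictionError P l :=
  Finset.sum_nonneg fun _ _ => le_min (hP.nonneg _ _) (hP.nonneg _ _)

theorem Stationary.predictionError_le {P : WordWeight} (hP : Stationary P) (l : ℕ) :
    predictionError P l ≤ 1 / 2 := by
  have h := hP.sum_eq_one l
  rw [predictionError, contextSum]
  calc _ ≤ ∑ v : Word l, P l v / 2 := Finset.sum_le_sum fun v _ => by
        rw [← hP.snoc l v]
        have := min_le_left (P (l + 1) (snocWord v false)) (P (l + 1) (snocWord v true))
        have := min_le_right (P (l + 1) (snocWord v false)) (P (l + 1) (snocWord v true))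
        linarith
    _ = 1 / 2 := by rw [← Finset.sum_div, h]

theorem Stationary.wordEntropy_zero {P : WordWeight} (hP : Stationary P) : wordEntropy P 0 = 0 := by
  simp [wordEntropy, hP.empty]

/-- The chain rule for entropy. -/
theorem Stationary.wordEntropy_succ {P : WordWeight} (hP : Stationary P) (l : ℕ) :
    wordEntropy P (l + 1) = wordEntropy P l + contextSum splitEntropy P l := by
  rw [wordEntropy, sum_word_snoc, wordEntropy, contextSum, ← Finset.sum_add_distrib]
  refine Finset.sum_congr rfl fun v _ => ?_
  rw [splitEntropy, hP.snoc]
  ring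

theorem Stationary.entropyIncrement_succ_le {P : WordWeight} (hP : Stationary P) (l : ℕ) :
    contextSum splitEntropy P (l + 1) ≤ contextSum splitEntropy P l :=
  hP.contextSum_succ_le (fun _ _ _ _ hs ht hs' ht' => splitEntropy_add_le hs ht hs' ht') l

theorem Stationary.le_entropyIncrement {P : WordWeight} (hP : Stationary P) (l : ℕ) :
    2 * Real.log 2 * predictionError P l ≤ contextSum splitEntropy P l := by
  rw [predictionError, contextSum, contextSum, Finset.mul_sum]
  exact Finset.sum_le_sum fun v _ =>
    two_log_two_mul_min_le_splitEntropy (hP.nonneg _ _) (hP.nonneg _ _)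

/-- Jensen's inequality for the binary entropy: the contexts are weighted by their masses, and the
weighted mean of the error rates is the prediction error. -/
theorem Stationary.entropyIncrement_le {P : WordWeight} (hP : Stationary P) (l : ℕ) :
    contextSum splitEntropy P l ≤ Real.binEntropy (predictionError P l) := by
  set s : Word l → ℝ := fun v => P (l + 1) (snocWord v false)
  set t : Word l → ℝ := fun v => P (l + 1) (snocWord v true)
  have hs : ∀ v, 0 ≤ s v := fun v => hP.nonneg _ _
  have ht : ∀ v, 0 ≤ t v := fun v => hP.nonneg _ _
  have key := Real.strictConcave_binEntropy.concaveOn.le_map_sum (t := Finset.univ)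
    (w := fun v => s v + t v) (p := fun v => min (s v) (t v) / (s v + t v))
    (fun v _ => add_nonneg (hs v) (ht v))
    (by rw [← hP.sum_eq_one l]; exact Finset.sum_congr rfl fun v _ => hP.snoc l v)
    (fun v _ => ⟨div_nonneg (le_min (hs v) (ht v)) (add_nonneg (hs v) (ht v)),
      div_le_one_of_le₀ (le_trans (min_le_left _ _) (le_add_of_nonneg_right (ht v)))
        (add_nonneg (hs v) (ht v))⟩)
  have e1 : contextSum splitEntropy P l =
      ∑ v, (s v + t v) • Real.binEntropy (min (s v) (t v) / (s v + t v)) :=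
    Finset.sum_congr rfl fun v _ => splitEntropy_eq_min (hs v) (ht v)
  have e2 : predictionError P l = ∑ v, (s v + t v) • (min (s v) (t v) / (s v + t v)) := by
    refine Finset.sum_congr rfl fun v _ => ?_
    -- In a context of mass zero the error rate is `0 / 0 = 0`, and both sides vanish.
    rcases (add_nonneg (hs v) (ht v)).eq_or_lt with h | h
    · have h1 : s v = 0 := by linarith [hs v, ht v]
      have h2 : t v = 0 := by linarith [hs v, ht v]
      change min (s v) (t v) = _
      simp [h1, h2]
    · rw [smul_eq_mul, mul_div_cancel₀ _ h.ne']
  rw [e1, e2]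
  exact key

theorem Stationary.reversal {P : WordWeight} (hP : Stationary P) : Stationary (reversal P) where
  nonneg _ _ := hP.nonneg _ _
  empty _ := hP.empty _
  snoc l v := by
    simp only [RauzyEntropy.reversal, snocWord, Fin.snoc_comp_rev]
    exact hP.cons l _
  cons l v := by
    simp only [RauzyEntropy.reversal, consWord, Fin.cons_comp_rev]
    exact hP.snoc l _

theorem sum_comp_rev {l : ℕ} (F : Word l → ℝ) : ∑ u : Word l, F (u ∘ Fin.rev) = ∑ u, F u :=
  Equiv.sum_comp (Equiv.arrowCongr Fin.revPerm (Equiv.refl Bool)) F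

theorem wordEntropy_reversal (P : WordWeight) (l : ℕ) :
    wordEntropy (reversal P) l = wordEntropy P l :=
  sum_comp_rev fun u => Real.negMulLog (P l u)

theorem predictionError_reversal (P : WordWeight) (l : ℕ) :
    predictionError (reversal P) l =
      ∑ v : Word l, min (P (l + 1) (consWord false v)) (P (l + 1) (consWord true v)) := by
  rw [← sum_comp_rev]
  refine Finset.sum_congr rfl fun v _ => ?_
  simp only [reversal, snocWord, consWord, Fin.snoc_comp_rev]

/-! ### The Rauzy functions and block entropy of a prefix in terms of word counts -/

/-- The word of length `l` at position `i` of `x`. -/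
def window (x : BinSeq) (l i : ℕ) : Word l := fun j => x (i + j)

/-- The number of positions below `N` at which `u` occurs in `x`. -/
def count (x : BinSeq) {l : ℕ} (u : Word l) (N : ℕ) : ℕ :=
  ∑ i ∈ Finset.range N, if window x l i = u then 1 else 0

/-- The frequencies of words in the prefix of length `n` of `x`. -/
noncomputable def prefixWeight (x : BinSeq) (n : ℕ) : WordWeight := fun _ u => freq (pre x n) u

theorem window_eq_snocWord {x : BinSeq} {l i : ℕ} {v : Word l} {c : Bool} :
    window x (l + 1) i = snocWord v c ↔ window x l i = v ∧ x (i + l) = c := by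
  constructor
  · intro h
    refine ⟨funext fun j => ?_, ?_⟩
    · simpa [window] using congrFun h j.castSucc
    · simpa [window] using congrFun h (Fin.last l)
  · rintro ⟨rfl, rfl⟩
    funext j
    refine Fin.lastCases ?_ (fun j => ?_) j <;> simp [window]

theorem window_eq_consWord {x : BinSeq} {l i : ℕ} {v : Word l} {c : Bool} :
    window x (l + 1) i = consWord c v ↔ window x l (i + 1) = v ∧ x i = c := by
  constructor
  · intro h
    refine ⟨funext fun j => ?_, ?_⟩
    · simpa [window, add_assoc, add_comm 1] using congrFun h j.succ
    · simpa [window] using congrFun h 0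
  · rintro ⟨rfl, rfl⟩
    funext j
    refine Fin.cases ?_ (fun j => ?_) j <;> simp [window, add_assoc, add_comm 1]

theorem card_filter_fin (N : ℕ) (p : ℕ → Prop) [DecidablePred p] :
    (Finset.univ.filter fun i : Fin N => p i).card =
      ∑ i ∈ Finset.range N, if p i then 1 else 0 := by
  rw [Finset.card_filter, ← Fin.sum_univ_eq_sum_range fun i => if p i then 1 else 0]

theorem occ_pre (x : BinSeq) (n : ℕ) {l : ℕ} (u : Word l) :
    occ (pre x n) u = count x u (n + 1 - l) := by
  rw [count, ← card_filter_fin, occ]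
  congr 1
  ext i
  rw [Finset.mem_filter, Finset.mem_filter]
  simp [window, pre, funext_iff]

/-- The value of `f` at each context is free, so the minimum is taken term by term. -/
theorem inf'_sum_cond {ι : Type*} [Fintype ι] [DecidableEq ι] (a b : ι → ℕ) :
    (Finset.univ.inf' Finset.univ_nonempty fun f : ι → Bool =>
      ∑ v, if f v then a v else b v) = ∑ v, min (a v) (b v) := by
  apply le_antisymm
  · refine (Finset.inf'_le _ (Finset.mem_univ fun v => decide (a v ≤ b v))).trans (le_of_eq ?_)
    refine Finset.sum_congr rfl fun v _ => ?_
    by_cases h : a v ≤ b v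
    · simp [h]
    · simp [h, le_of_not_ge h]
  · refine Finset.le_inf' _ _ fun f _ => Finset.sum_le_sum fun v _ => ?_
    split_ifs
    · exact min_le_left _ _
    · exact min_le_right _ _

/-- Positions are grouped by their context; in the context `v` the errors are the occurrences of `v`
followed by the symbol not predicted. -/
theorem gammaErrors_pre (x : BinSeq) (n l : ℕ) (f : Word l → Bool) :
    gammaErrors l (pre x n) f = ∑ v, if f v then count x (snocWord v false) (n - l)
      else count x (snocWord v true) (n - l) := by
  have h1 : gammaErrors l (pre x n) f =
      ∑ i ∈ Finset.range (n - l), if x (i + l) ≠ f (window x l i) then 1 else 0 := by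
    rw [← card_filter_fin]
    rfl
  have h2 : ∀ v, (if f v then count x (snocWord v false) (n - l)
      else count x (snocWord v true) (n - l)) = count x (snocWord v (!f v)) (n - l) := by
    intro v
    cases f v <;> rfl
  simp only [h1, h2]
  simp only [count]
  rw [Finset.sum_comm]
  refine Finset.sum_congr rfl fun i _ => ?_
  rw [Finset.sum_eq_single (window x l i)]
  · simp only [window_eq_snocWord]
    cases x (i + l) <;> cases f (window x l i) <;> simp
  · intro v _ hv
    simp [window_eq_snocWord, hv.symm]
  · simp

theorem betaErrors_pre (x : BinSeq) (n l : ℕ) (f : Word l → Bool) :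
    betaErrors l (pre x n) f = ∑ v, if f v then count x (consWord false v) (n - l)
      else count x (consWord true v) (n - l) := by
  have h1 : betaErrors l (pre x n) f =
      ∑ i ∈ Finset.range (n - l), if x i ≠ f (window x l (i + 1)) then 1 else 0 := by
    rw [← card_filter_fin]
    rfl
  have h2 : ∀ v, (if f v then count x (consWord false v) (n - l)
      else count x (consWord true v) (n - l)) = count x (consWord (!f v) v) (n - l) := by
    intro v
    cases f v <;> rfl
  simp only [h1, h2]
  simp only [count]
  rw [Finset.sum_comm]
  refine Finset.sum_congr rfl fun i _ => ?_
  rw [Finset.sum_eq_single (window x l (i + 1))]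
  · simp only [window_eq_consWord]
    cases x i <;> cases f (window x l (i + 1)) <;> simp
  · intro v _ hv
    simp [window_eq_consWord, hv.symm]
  · simp

theorem sum_min_count_div (x : BinSeq) {n l : ℕ} (h : l ≤ n) (s t : Word l → Word (l + 1)) :
    ((∑ v, min (count x (s v) (n - l)) (count x (t v) (n - l)) : ℕ) : ℝ) / ((n : ℝ) - l) =
      ∑ v, min (prefixWeight x n (l + 1) (s v)) (prefixWeight x n (l + 1) (t v)) := by
  have hd : (0 : ℝ) ≤ (n : ℝ) - l := by
    rw [sub_nonneg]
    exact_mod_cast h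
  -- A prefix of length `n` has `n - l` factors of length `l + 1`, which is also the number of
  -- predicted positions, so the identity is exact.
  have he : (n : ℝ) - ((l + 1 : ℕ) : ℝ) + 1 = n - l := by
    push_cast
    ring
  rw [Nat.cast_sum, Finset.sum_div]
  refine Finset.sum_congr rfl fun v _ => ?_
  rw [prefixWeight, prefixWeight, freq, freq, he, occ_pre, occ_pre, Nat.add_sub_add_right,
    min_div_div_right hd, Nat.cast_min]

theorem gammaWord_pre (x : BinSeq) {n l : ℕ} (h : l ≤ n) :
    gammaWord l (pre x n) = predictionError (prefixWeight x n) l := by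
  rw [gammaWord, funext (gammaErrors_pre x n l), inf'_sum_cond, sum_min_count_div x h]
  rfl

theorem betaWord_pre (x : BinSeq) {n l : ℕ} (h : l ≤ n) :
    betaWord l (pre x n) = predictionError (reversal (prefixWeight x n)) l := by
  rw [betaWord, funext (betaErrors_pre x n l), inf'_sum_cond,
    sum_min_count_div x h (fun v => consWord false v) (fun v => consWord true v),
    predictionError_reversal]

theorem blockEntropyWord_pre (x : BinSeq) (n l : ℕ) :
    blockEntropyWord l (pre x n) = wordEntropy (prefixWeight x n) l / l / Real.log 2 := by
  rw [blockEntropyWord, wordEntropy, div_div, Finset.sum_div, Finset.mul_sum]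
  refine Finset.sum_congr rfl fun u _ => ?_
  rw [Real.negMulLog, Real.logb, prefixWeight]
  ring

theorem count_le (x : BinSeq) {l : ℕ} (u : Word l) (N : ℕ) : count x u N ≤ N := by
  rw [count]
  refine (Finset.sum_le_card_nsmul _ _ 1 fun i _ => ?_).trans (by simp)
  split_ifs <;> simp

theorem prefixWeight_mem_Icc (x : BinSeq) {n l : ℕ} (h : l ≤ n) (u : Word l) :
    prefixWeight x n l u ∈ Set.Icc (0 : ℝ) 1 := by
  have hd : (n : ℝ) - l + 1 = ((n + 1 - l : ℕ) : ℝ) := by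
    rw [Nat.cast_sub (by omega)]
    push_cast
    ring
  rw [prefixWeight, freq, hd, occ_pre]
  exact ⟨by positivity, div_le_one_of_le₀ (by exact_mod_cast count_le x u _) (by positivity)⟩

theorem Stationary.mem_Icc {P : WordWeight} (hP : Stationary P) (l : ℕ) (u : Word l) :
    P l u ∈ Set.Icc (0 : ℝ) 1 := by
  refine ⟨hP.nonneg l u, ?_⟩
  rw [← hP.sum_eq_one l]
  exact Finset.single_le_sum (fun v _ => hP.nonneg l v) (Finset.mem_univ u)

/-! ### Stability under small changes of the word weights -/

theorem tendsto_predictionError_sub {Q P : ℕ → WordWeight}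
    (h : ∀ l (u : Word l), Tendsto (fun n => Q n l u - P n l u) atTop (𝓝 0)) (l : ℕ) :
    Tendsto (fun n => predictionError (Q n) l - predictionError (P n) l) atTop (𝓝 0) := by
  simp only [predictionError, contextSum, ← Finset.sum_sub_distrib]
  rw [← Finset.sum_const_zero (ι := Word l) (s := Finset.univ)]
  refine tendsto_finsetSum _ fun v _ => ?_
  have h1 := (h (l + 1) (snocWord v false)).abs.add (h (l + 1) (snocWord v true)).abs
  rw [abs_zero, add_zero] at h1
  refine squeeze_zero_norm (fun n => ?_) h1
  exact (abs_min_sub_min_le_max _ _ _ _).trans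
    (max_le_add_of_nonneg (abs_nonneg _) (abs_nonneg _))

/-- Neither sequence need converge, so uniform continuity on `[0, 1]` is what is needed. It serves
for `negMulLog`, which is not Lipschitz at `0`. -/
theorem tendsto_comp_sub_comp {F : ℝ → ℝ} (hF : Continuous F) {a b : ℕ → ℝ}
    (ha : ∀ᶠ n in atTop, a n ∈ Set.Icc (0 : ℝ) 1) (hb : ∀ᶠ n in atTop, b n ∈ Set.Icc (0 : ℝ) 1)
    (h : Tendsto (fun n => a n - b n) atTop (𝓝 0)) :
    Tendsto (fun n => F (a n) - F (b n)) atTop (𝓝 0) := by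
  have hu := (isCompact_Icc (a := (0 : ℝ)) (b := 1)).uniformContinuousOn_of_continuous
    hF.continuousOn
  rw [Metric.uniformContinuousOn_iff] at hu
  rw [Metric.tendsto_atTop] at h ⊢
  intro ε hε
  obtain ⟨δ, hδ, hd⟩ := hu ε hε
  obtain ⟨N, hN⟩ := h δ hδ
  obtain ⟨N', hN'⟩ := eventually_atTop.1 (ha.and hb)
  refine ⟨max N N', fun n hn => ?_⟩
  have := hd _ (hN' n (le_of_max_le_right hn)).1 _ (hN' n (le_of_max_le_right hn)).2
    (by simpa [Real.dist_eq] using hN n (le_of_max_le_left hn))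
  simpa [Real.dist_eq] using this

theorem tendsto_wordEntropy_sub {Q P : ℕ → WordWeight}
    (hQ : ∀ l (u : Word l), ∀ᶠ n in atTop, Q n l u ∈ Set.Icc (0 : ℝ) 1)
    (hP : ∀ l (u : Word l), ∀ᶠ n in atTop, P n l u ∈ Set.Icc (0 : ℝ) 1)
    (h : ∀ l (u : Word l), Tendsto (fun n => Q n l u - P n l u) atTop (𝓝 0)) (l : ℕ) :
    Tendsto (fun n => wordEntropy (Q n) l - wordEntropy (P n) l) atTop (𝓝 0) := by
  simp only [wordEntropy, ← Finset.sum_sub_distrib]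
  rw [← Finset.sum_const_zero (ι := Word l) (s := Finset.univ)]
  exact tendsto_finsetSum _ fun u _ =>
    tendsto_comp_sub_comp Real.continuous_negMulLog (hQ l u) (hP l u) (h l u)

theorem tendsto_gammaWord_sub {x : BinSeq} {P : ℕ → WordWeight}
    (h : ∀ l (u : Word l), Tendsto (fun n => prefixWeight x n l u - P n l u) atTop (𝓝 0))
    (l : ℕ) :
    Tendsto (fun n => gammaWord l (pre x n) - predictionError (P n) l) atTop (𝓝 0) := by
  refine (tendsto_predictionError_sub h l).congr' ?_
  filter_upwards [eventually_ge_atTop l] with n hn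
  rw [gammaWord_pre x hn]

theorem tendsto_betaWord_sub {x : BinSeq} {P : ℕ → WordWeight}
    (h : ∀ l (u : Word l), Tendsto (fun n => prefixWeight x n l u - P n l u) atTop (𝓝 0))
    (l : ℕ) :
    Tendsto (fun n => betaWord l (pre x n) - predictionError (reversal (P n)) l) atTop (𝓝 0) := by
  refine (tendsto_predictionError_sub (Q := fun n => reversal (prefixWeight x n))
    (P := fun n => reversal (P n)) (fun l u => h l _) l).congr' ?_
  filter_upwards [eventually_ge_atTop l] with n hn
  rw [betaWord_pre x hn]

theorem tendsto_blockEntropyWord_sub {x : BinSeq} {P : ℕ → WordWeight}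
    (hP : ∀ n, Stationary (P n))
    (h : ∀ l (u : Word l), Tendsto (fun n => prefixWeight x n l u - P n l u) atTop (𝓝 0))
    (l : ℕ) :
    Tendsto (fun n => blockEntropyWord l (pre x n) - wordEntropy (P n) l / l / Real.log 2)
      atTop (𝓝 0) := by
  have h1 := ((tendsto_wordEntropy_sub (Q := prefixWeight x) (P := P)
    (fun l u => (eventually_ge_atTop l).mono fun n hn => prefixWeight_mem_Icc x hn u)
    (fun l u => Eventually.of_forall fun n => (hP n).mem_Icc l u) h l).div_const (l : ℝ)).div_const
    (Real.log 2)
  rw [zero_div, zero_div] at h1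
  refine h1.congr fun n => ?_
  rw [blockEntropyWord_pre, sub_div, sub_div]

/-! ### Closing a prefix into a cycle -/

/-- The infinite repetition of the prefix of length `n + 1` of `x`. -/
def cyclicSeq (x : BinSeq) (n : ℕ) : BinSeq := fun i => x (i % (n + 1))

/-- The frequencies of words in the prefix of length `n + 1` of `x`, read cyclically. -/
noncomputable def cyclicWeight (x : BinSeq) (n : ℕ) : WordWeight :=
  fun _ u => count (cyclicSeq x n) u (n + 1) / ((n + 1 : ℕ) : ℝ)

theorem count_snocWord_add (x : BinSeq) {l : ℕ} (v : Word l) (N : ℕ) :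
    count x (snocWord v false) N + count x (snocWord v true) N = count x v N := by
  simp only [count, ← Finset.sum_add_distrib, window_eq_snocWord]
  refine Finset.sum_congr rfl fun i _ => ?_
  cases x (i + l) <;> simp

theorem window_cyclicSeq_add (x : BinSeq) (n l i : ℕ) :
    window (cyclicSeq x n) l (i + (n + 1)) = window (cyclicSeq x n) l i := by
  funext j
  simp only [window, cyclicSeq]
  rw [add_right_comm, Nat.add_mod_right]

/-- This is where cyclic reading matters: moving the starting position by one permutes the `n + 1`
positions of the cycle, so no boundary term appears. -/
theorem count_consWord_add (x : BinSeq) (n : ℕ) {l : ℕ} (v : Word l) :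
    count (cyclicSeq x n) (consWord false v) (n + 1) +
      count (cyclicSeq x n) (consWord true v) (n + 1) = count (cyclicSeq x n) v (n + 1) := by
  have h : ∑ i ∈ Finset.range (n + 1), (if window (cyclicSeq x n) l (i + 1) = v then 1 else 0) =
      count (cyclicSeq x n) v (n + 1) := by
    have h1 := Finset.sum_range_succ (fun i => if window (cyclicSeq x n) l i = v then 1 else 0)
      (n + 1)
    rw [Finset.sum_range_succ', ← zero_add (n + 1), window_cyclicSeq_add, zero_add] at h1
    exact Nat.add_right_cancel h1
  rw [← h]
  simp only [count, ← Finset.sum_add_distrib, window_eq_consWord]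
  refine Finset.sum_congr rfl fun i _ => ?_
  cases cyclicSeq x n i <;> simp

theorem stationary_cyclicWeight (x : BinSeq) (n : ℕ) : Stationary (cyclicWeight x n) where
  nonneg _ _ := by
    rw [cyclicWeight]
    positivity
  empty u := by
    have h : ∀ i, window (cyclicSeq x n) 0 i = u := fun i => Subsingleton.elim _ _
    have : ((n : ℝ) + 1) ≠ 0 := by positivity
    simp [cyclicWeight, count, h, this]
  snoc l v := by
    simp only [cyclicWeight]
    rw [← add_div, ← Nat.cast_add, count_snocWord_add]
  cons l v := by
    simp only [cyclicWeight]
    rw [← add_div, ← Nat.cast_add, count_consWord_add]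

/-- Windows that start before `n + 1 - l` do not wrap around; the other `l` starting positions
contribute at most `l`. -/
theorem count_le_count_cyclicSeq (x : BinSeq) {n l : ℕ} (h : l ≤ n + 1) (u : Word l) :
    count x u (n + 1 - l) ≤ count (cyclicSeq x n) u (n + 1) ∧
      count (cyclicSeq x n) u (n + 1) ≤ count x u (n + 1 - l) + l := by
  have h1 : count x u (n + 1 - l) = count (cyclicSeq x n) u (n + 1 - l) := by
    refine Finset.sum_congr rfl fun i hi => ?_
    have : window (cyclicSeq x n) l i = window x l i := by
      funext j
      have := Finset.mem_range.1 hi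
      simp only [window, cyclicSeq]
      rw [Nat.mod_eq_of_lt (by omega)]
    rw [this]
  have h2 : count (cyclicSeq x n) u (n + 1) = count (cyclicSeq x n) u (n + 1 - l) +
      ∑ i ∈ Finset.range l, if window (cyclicSeq x n) l (n + 1 - l + i) = u then 1 else 0 := by
    have := Finset.sum_range_add (fun i => if window (cyclicSeq x n) l i = u then 1 else 0)
      (n + 1 - l) l
    rwa [Nat.sub_add_cancel h] at this
  have h3 : (∑ i ∈ Finset.range l,
      if window (cyclicSeq x n) l (n + 1 - l + i) = u then 1 else 0) ≤ l := by
    refine (Finset.sum_le_card_nsmul _ _ 1 fun i _ => ?_).trans (by simp)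
    split_ifs <;> simp
  omega

theorem tendsto_prefixWeight_sub_cyclicWeight (x : BinSeq) (l : ℕ) (u : Word l) :
    Tendsto (fun n => prefixWeight x n l u - cyclicWeight x n l u) atTop (𝓝 0) := by
  have hlim : Tendsto (fun n : ℕ => (l : ℝ) / ((n : ℝ) + 1)) atTop (𝓝 0) :=
    tendsto_const_nhds.div_atTop (tendsto_atTop_add_const_right _ _ tendsto_natCast_atTop_atTop)
  refine squeeze_zero_norm' ?_ hlim
  filter_upwards [eventually_ge_atTop l] with n hn
  obtain ⟨h1, h2⟩ := count_le_count_cyclicSeq x (by omega : l ≤ n + 1) u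
  have h3 := count_le x u (n + 1 - l)
  rw [prefixWeight, freq, occ_pre, cyclicWeight]
  set A := count x u (n + 1 - l)
  set C := count (cyclicSeq x n) u (n + 1)
  have h1' : (A : ℝ) ≤ C := by exact_mod_cast h1
  have h2' : (C : ℝ) ≤ A + l := by exact_mod_cast h2
  have h3' : (A : ℝ) ≤ n - l + 1 := by
    have : A + l ≤ n + 1 := by omega
    have : (A : ℝ) + l ≤ n + 1 := by exact_mod_cast this
    linarith
  have hl : (l : ℝ) ≤ n := by exact_mod_cast hn
  have hd : (0 : ℝ) < n - l + 1 := by linarith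
  have hN : (0 : ℝ) < n + 1 := by positivity
  -- Replacing the denominator `n - l + 1` by `n + 1` costs at most `l / (n + 1)`, because the
  -- frequency is at most `1`.
  have e : (A : ℝ) / (n - l + 1) = A / (n + 1) + (A / (n - l + 1)) * (l / (n + 1)) := by
    field_simp
    ring
  have h4 : (A : ℝ) / (n - l + 1) ≤ 1 := (div_le_one hd).2 h3'
  have h5 : (A : ℝ) / (n - l + 1) * (l / (n + 1)) ≤ l / (n + 1) :=
    mul_le_of_le_one_left (by positivity) h4
  have h6 : (0 : ℝ) ≤ (A : ℝ) / (n - l + 1) * (l / (n + 1)) := by positivity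
  have h7 : (A : ℝ) / (n + 1) ≤ C / (n + 1) := div_le_div_of_nonneg_right h1' hN.le
  have h8 : (C : ℝ) / (n + 1) ≤ A / (n + 1) + l / (n + 1) := by
    rw [← add_div]
    exact div_le_div_of_nonneg_right h2' hN.le
  rw [Real.norm_eq_abs, abs_le, e]
  push_cast
  constructor <;> linarith

/-! ### Block entropy rate against conditional entropy -/

theorem Stationary.entropyIncrement_antitone {P : WordWeight} (hP : Stationary P) :
    Antitone (contextSum splitEntropy P) :=
  antitone_nat_of_succ_le hP.entropyIncrement_succ_le

theorem Stationary.wordEntropy_add_le {P : WordWeight} (hP : Stationary P) (k m : ℕ) :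
    wordEntropy P (k + m) ≤ wordEntropy P k + m * contextSum splitEntropy P k := by
  induction m with
  | zero => simp
  | succ m ih =>
    have := hP.entropyIncrement_antitone (Nat.le_add_right k m)
    rw [← add_assoc, hP.wordEntropy_succ]
    push_cast
    linarith

theorem Stationary.wordEntropy_le {P : WordWeight} (hP : Stationary P) (l : ℕ) :
    wordEntropy P l ≤ l * Real.log 2 := by
  have h := hP.wordEntropy_add_le 0 l
  rw [zero_add, hP.wordEntropy_zero, zero_add] at h
  exact h.trans (mul_le_mul_of_nonneg_left
    ((hP.entropyIncrement_le 0).trans Real.binEntropy_le_log_two) l.cast_nonneg)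

/-- The word entropy is the sum of the `l` increments before the `l`-th, none of them smaller than
it. -/
theorem Stationary.mul_entropyIncrement_le {P : WordWeight} (hP : Stationary P) (l : ℕ) :
    l * contextSum splitEntropy P l ≤ wordEntropy P l := by
  induction l with
  | zero => simp [hP.wordEntropy_zero]
  | succ l ih =>
    have h := mul_le_mul_of_nonneg_left (hP.entropyIncrement_succ_le l)
      (by positivity : (0 : ℝ) ≤ (l + 1 : ℕ))
    rw [hP.wordEntropy_succ]
    push_cast at h ⊢
    linarith

theorem Stationary.entropyIncrement_nonneg {P : WordWeight} (hP : Stationary P) (l : ℕ) :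
    0 ≤ contextSum splitEntropy P l :=
  (mul_nonneg (by have := Real.log_nonneg one_le_two; positivity)
    (hP.predictionError_nonneg l)).trans (hP.le_entropyIncrement l)

theorem Stationary.wordEntropy_nonneg {P : WordWeight} (hP : Stationary P) (l : ℕ) :
    0 ≤ wordEntropy P l :=
  (mul_nonneg l.cast_nonneg (hP.entropyIncrement_nonneg l)).trans (hP.mul_entropyIncrement_le l)

/-- The Shannon entropy, in bits per symbol, of the words of length `l`. -/
noncomputable def entropyRate (P : WordWeight) (l : ℕ) : ℝ := wordEntropy P l / l / Real.log 2

theorem shannonH_eq (a : ℝ) : shannonH a = Real.binEntropy a / Real.log 2 := by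
  rw [shannonH, Real.binEntropy_eq_negMulLog_add_negMulLog_one_sub, Real.negMulLog, Real.negMulLog,
    Real.logb, Real.logb]
  ring

theorem Stationary.entropyRate_nonneg {P : WordWeight} (hP : Stationary P) (l : ℕ) :
    0 ≤ entropyRate P l :=
  div_nonneg (div_nonneg (hP.wordEntropy_nonneg l) l.cast_nonneg) (Real.log_nonneg one_le_two)

theorem Stationary.entropyRate_le_one {P : WordWeight} (hP : Stationary P) (l : ℕ) :
    entropyRate P l ≤ 1 := by
  refine div_le_one_of_le₀ ?_ (Real.log_nonneg one_le_two)
  exact div_le_of_le_mul₀ l.cast_nonneg (Real.log_nonneg one_le_two)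
    (by rw [mul_comm]; exact hP.wordEntropy_le l)

theorem Stationary.two_mul_predictionError_le {P : WordWeight} (hP : Stationary P) (l : ℕ) :
    2 * predictionError P l ≤ entropyRate P (l + 1) := by
  have hlog : 0 < Real.log 2 := Real.log_pos one_lt_two
  have hl : (0 : ℝ) < (l + 1 : ℕ) := by positivity
  rw [entropyRate, le_div_iff₀ hlog, le_div_iff₀ hl]
  have h1 := hP.le_entropyIncrement l
  have h2 := hP.mul_entropyIncrement_le l
  have h3 := mul_le_mul_of_nonneg_right h1 hl.le
  rw [hP.wordEntropy_succ]
  push_cast at h3 ⊢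
  linarith

/-- The running mean of a decreasing sequence decreases. Lengths start at `1`, since the rate at
length `0` is the default value `0`. -/
theorem Stationary.entropyRate_succ_le {P : WordWeight} (hP : Stationary P) (l : ℕ) :
    entropyRate P (l + 1 + 1) ≤ entropyRate P (l + 1) := by
  have hl : (0 : ℝ) < (l + 1 : ℕ) := by positivity
  have hl' : (0 : ℝ) < (l + 1 + 1 : ℕ) := by positivity
  refine div_le_div_of_nonneg_right ?_ (Real.log_nonneg one_le_two)
  rw [div_le_div_iff₀ hl' hl, hP.wordEntropy_succ (l + 1)]
  have := hP.mul_entropyIncrement_le (l + 1)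
  push_cast at this ⊢
  linarith

/-- The first `k` symbols cost at most one bit each, and every later one at most the conditional
entropy given `k` symbols. -/
theorem Stationary.entropyRate_add_le {P : WordWeight} (hP : Stationary P) (k m : ℕ) :
    entropyRate P (k + (m + 1)) ≤ k / (k + (m + 1)) + shannonH (predictionError P k) := by
  have hlog : 0 < Real.log 2 := Real.log_pos one_lt_two
  have hkm : (0 : ℝ) < k + (m + 1) := by positivity
  have hB : 0 ≤ Real.binEntropy (predictionError P k) :=
    Real.binEntropy_nonneg (hP.predictionError_nonneg k) ((hP.predictionError_le k).trans
      (by norm_num))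
  have h1 := hP.wordEntropy_add_le k (m + 1)
  have h2 := hP.wordEntropy_le k
  have h3 := mul_le_mul_of_nonneg_left (hP.entropyIncrement_le k)
    (by positivity : (0 : ℝ) ≤ (m + 1 : ℕ))
  rw [entropyRate, shannonH_eq, div_le_iff₀ hlog, add_mul, div_mul_cancel₀ _ hlog.ne']
  push_cast at h1 h3 ⊢
  rw [div_le_iff₀ hkm]
  have e : ((k : ℝ) / (k + (m + 1)) * Real.log 2 + Real.binEntropy (predictionError P k)) *
      (k + (m + 1)) = k * Real.log 2 + (k + (m + 1)) * Real.binEntropy (predictionError P k) := by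
    field_simp
  rw [e]
  have h4 := mul_nonneg k.cast_nonneg (α := ℝ) hB
  linarith

/-! ### Passing to lower and upper limits -/

/-- The properties that `liminf` and `limsup` share on bounded sequences. -/
structure LimitLike (Λ : (ℕ → ℝ) → ℝ) : Prop where
  mono : ∀ (u v : ℕ → ℝ) (C : ℝ), (∀ᶠ n in atTop, |u n| ≤ C) → (∀ᶠ n in atTop, |v n| ≤ C) →
    (∀ᶠ n in atTop, u n ≤ v n) → Λ u ≤ Λ v
  map : ∀ (φ : ℝ → ℝ) (u : ℕ → ℝ) (C : ℝ), Monotone φ → Continuous φ →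
    (∀ᶠ n in atTop, |u n| ≤ C) → Λ (fun n => φ (u n)) = φ (Λ u)

theorem limitLike_liminf : LimitLike fun u => liminf u atTop where
  mono _ _ C hu hv h :=
    liminf_le_liminf h (isBoundedUnder_of_eventually_ge (a := -C)
        (hu.mono fun _ hn => (abs_le.1 hn).1))
      ((isBoundedUnder_of_eventually_le (a := C)
        (hv.mono fun _ hn => (abs_le.1 hn).2)).isCoboundedUnder_ge)
  map _ u C hφ hc hu :=
    (hφ.map_liminf_of_continuousAt u hc.continuousAt
      ((isBoundedUnder_of_eventually_le (a := C)
        (hu.mono fun _ hn => (abs_le.1 hn).2)).isCoboundedUnder_ge)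
      (isBoundedUnder_of_eventually_ge (a := -C) (hu.mono fun _ hn => (abs_le.1 hn).1))).symm

theorem limitLike_limsup : LimitLike fun u => limsup u atTop where
  mono _ _ C hu hv h :=
    limsup_le_limsup h ((isBoundedUnder_of_eventually_ge (a := -C)
        (hu.mono fun _ hn => (abs_le.1 hn).1)).isCoboundedUnder_le)
      (isBoundedUnder_of_eventually_le (a := C) (hv.mono fun _ hn => (abs_le.1 hn).2))
  map _ u C hφ hc hu :=
    (hφ.map_limsup_of_continuousAt u hc.continuousAt
      (isBoundedUnder_of_eventually_le (a := C) (hu.mono fun _ hn => (abs_le.1 hn).2))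
      ((isBoundedUnder_of_eventually_ge (a := -C)
        (hu.mono fun _ hn => (abs_le.1 hn).1)).isCoboundedUnder_le)).symm

theorem LimitLike.const {Λ : (ℕ → ℝ) → ℝ} (hΛ : LimitLike Λ) (c : ℝ) : Λ (fun _ => c) = c :=
  hΛ.map (fun _ => c) (fun _ => 0) 0 monotone_const continuous_const (by simp)

theorem LimitLike.le_of_tendsto_sub {Λ : (ℕ → ℝ) → ℝ} (hΛ : LimitLike Λ) {u v : ℕ → ℝ} {C : ℝ}
    (hu : ∀ᶠ n in atTop, |u n| ≤ C) (hv : ∀ᶠ n in atTop, |v n| ≤ C)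
    (h : Tendsto (fun n => u n - v n) atTop (𝓝 0)) : Λ u ≤ Λ v := by
  refine le_of_forall_pos_le_add fun ε hε => ?_
  rw [← hΛ.map (fun t => t + ε) v C (fun a b hab => add_le_add_left hab ε)
    (continuous_id.add continuous_const) hv]
  refine hΛ.mono u _ (C + ε) (hu.mono fun n hn => hn.trans (by linarith))
    (hv.mono fun n hn => (abs_add_le _ _).trans (by rw [abs_of_pos hε]; linarith)) ?_
  filter_upwards [h.eventually (gt_mem_nhds hε)] with n hn
  linarith

theorem LimitLike.eq_of_tendsto_sub {Λ : (ℕ → ℝ) → ℝ} (hΛ : LimitLike Λ) {u v : ℕ → ℝ} {C : ℝ}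
    (hv : ∀ n, |v n| ≤ C) (h : Tendsto (fun n => u n - v n) atTop (𝓝 0)) : Λ u = Λ v := by
  have hu : ∀ᶠ n in atTop, |u n| ≤ C + 1 := by
    have := (tendsto_zero_iff_abs_tendsto_zero _).1 h
    filter_upwards [this.eventually (gt_mem_nhds one_pos)] with n hn
    have h1 := abs_add_le (u n - v n) (v n)
    rw [sub_add_cancel] at h1
    have := hv n
    simp only [Function.comp] at hn
    linarith
  have hv' : ∀ᶠ n in atTop, |v n| ≤ C + 1 := Eventually.of_forall fun n => (hv n).trans (by linarith)
  refine le_antisymm (hΛ.le_of_tendsto_sub hu hv' h) (hΛ.le_of_tendsto_sub hv' hu ?_)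
  simpa using h.neg

/-- `shannonH`, made constant outside of the interval on which it increases. -/
noncomputable def clampedH (t : ℝ) : ℝ := shannonH (max 0 (min t 2⁻¹))

theorem clampedH_eq {t : ℝ} (h0 : 0 ≤ t) (h1 : t ≤ 1 / 2) : clampedH t = shannonH t := by
  rw [clampedH, min_eq_left (by linarith), max_eq_right h0]

/-- `LimitLike.map` asks for a map that is monotone and continuous on all of `ℝ`, hence the
clamping. -/
theorem continuous_clampedH : Continuous clampedH := by
  have : clampedH = fun t => Real.binEntropy (max 0 (min t 2⁻¹)) / Real.log 2 :=
    funext fun t => shannonH_eq _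
  rw [this]
  exact (Real.binEntropy_continuous.comp
    (continuous_const.max (continuous_id.min continuous_const))).div_const _

theorem monotone_clampedH : Monotone clampedH := by
  intro s t hst
  rw [clampedH, clampedH, shannonH_eq, shannonH_eq]
  refine div_le_div_of_nonneg_right ?_ (Real.log_nonneg one_le_two)
  refine Real.binEntropy_strictMonoOn.monotoneOn ?_ ?_ (max_le_max_left _ (min_le_min_right _ hst))
  all_goals exact ⟨le_max_left _ _, max_le (by norm_num) (min_le_right _ _)⟩

/-- The inequalities between error and rate hold for each `P n`; applying `Λ` in `n` preserves them
and the monotonicity in `l`, which yields the limits in `l`. -/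
theorem LimitLike.entropy_bounds {Λ : (ℕ → ℝ) → ℝ} (hΛ : LimitLike Λ) {P : ℕ → WordWeight}
    (hP : ∀ n, Stationary (P n)) {g e : ℕ → ℕ → ℝ}
    (hg : ∀ l, Tendsto (fun n => g l n - predictionError (P n) l) atTop (𝓝 0))
    (he : ∀ l, Tendsto (fun n => e l n - entropyRate (P n) l) atTop (𝓝 0)) :
    ∃ γ h, Tendsto (fun l => Λ (g l)) atTop (𝓝 γ) ∧ Tendsto (fun l => Λ (e l)) atTop (𝓝 h) ∧
      2 * γ ≤ h ∧ h ≤ shannonH γ := by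
  have hG0 : ∀ l n, 0 ≤ predictionError (P n) l := fun l n => (hP n).predictionError_nonneg l
  have hG1 : ∀ l n, predictionError (P n) l ≤ 1 / 2 := fun l n => (hP n).predictionError_le l
  have hG : ∀ l n, |predictionError (P n) l| ≤ 1 := fun l n =>
    abs_le.2 ⟨by linarith [hG0 l n], by linarith [hG1 l n]⟩
  have hE : ∀ l n, |entropyRate (P n) l| ≤ 1 := fun l n =>
    abs_le.2 ⟨by linarith [(hP n).entropyRate_nonneg l], (hP n).entropyRate_le_one l⟩
  simp only [fun l => hΛ.eq_of_tendsto_sub (hG l) (hg l),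
    fun l => hΛ.eq_of_tendsto_sub (hE l) (he l)]
  set G : ℕ → ℝ := fun l => Λ fun n => predictionError (P n) l with hGdef
  set E : ℕ → ℝ := fun l => Λ fun n => entropyRate (P n) l with hEdef
  have mono : ∀ {u v : ℕ → ℝ} (C : ℝ), (∀ n, |u n| ≤ C) → (∀ n, |v n| ≤ C) → (∀ n, u n ≤ v n) →
      Λ u ≤ Λ v := fun C hu hv huv =>
    hΛ.mono _ _ C (Eventually.of_forall hu) (Eventually.of_forall hv) (Eventually.of_forall huv)
  have hGanti : Antitone G := antitone_nat_of_succ_le fun l =>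
    mono 1 (hG _) (hG _) fun n => (hP n).predictionError_succ_le l
  have hEanti : Antitone fun l => E (l + 1) := antitone_nat_of_succ_le fun l =>
    mono 1 (hE _) (hE _) fun n => (hP n).entropyRate_succ_le l
  have hGnonneg : ∀ l, 0 ≤ G l := fun l => by
    rw [← hΛ.const 0]
    exact mono 1 (by simp) (hG l) (hG0 l)
  have hGhalf : ∀ l, G l ≤ 1 / 2 := fun l => by
    rw [← hΛ.const (1 / 2)]
    exact mono 1 (hG l) (by intro n; rw [abs_le]; norm_num) (hG1 l)
  have hEnonneg : ∀ l, 0 ≤ E l := fun l => by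
    rw [← hΛ.const 0]
    exact mono 1 (by simp) (hE l) fun n => (hP n).entropyRate_nonneg l
  have hGlim : Tendsto G atTop (𝓝 (⨅ l, G l)) :=
    tendsto_atTop_ciInf hGanti ⟨0, by rintro _ ⟨l, rfl⟩; exact hGnonneg l⟩
  have hElim' : Tendsto (fun l => E (l + 1)) atTop (𝓝 (⨅ l, E (l + 1))) :=
    tendsto_atTop_ciInf hEanti ⟨0, by rintro _ ⟨l, rfl⟩; exact hEnonneg _⟩
  have hElim := (tendsto_add_atTop_iff_nat 1).1 hElim'
  refine ⟨_, _, hGlim, hElim, ?_, ?_⟩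
  · refine le_of_tendsto_of_tendsto' (hGlim.const_mul 2) hElim' fun l => ?_
    rw [hGdef, hEdef]
    simp only
    rw [← hΛ.map (fun t => 2 * t) _ 1 (fun a b hab => by simpa using hab)
      (continuous_const.mul continuous_id) (Eventually.of_forall (hG l))]
    refine mono 2 (fun n => ?_) (fun n => (hE _ n).trans one_le_two) fun n =>
      (hP n).two_mul_predictionError_le l
    rw [abs_mul, abs_two]
    linarith [hG l n]
  -- For a fixed context length `k` the cost of the first `k` symbols disappears as the word length
  -- grows; only afterwards does `k` tend to infinity.
  · have hH : ∀ k, (⨅ l, E (l + 1)) ≤ clampedH (G k) := by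
      intro k
      have h1 : ∀ m : ℕ, E (m + (k + 1)) ≤ k / (k + ((m : ℝ) + 1)) + clampedH (G k) := by
        intro m
        have hc : (0 : ℝ) ≤ k / (k + (m + 1)) := by positivity
        rw [hGdef, hEdef]
        simp only
        rw [← hΛ.map (fun t => k / (k + ((m : ℝ) + 1)) + clampedH t) _ 1
          (fun a b hab => add_le_add_right (monotone_clampedH hab) _)
          (continuous_const.add continuous_clampedH) (Eventually.of_forall (hG k))]
        refine hΛ.mono _ _ (k / (k + (m + 1)) + clampedH (1 / 2) + 1)
          (Eventually.of_forall fun n => ?_) (Eventually.of_forall fun n => ?_)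
          (Eventually.of_forall fun n => ?_)
        · have : 0 ≤ clampedH (1 / 2) := by
            rw [clampedH_eq (by norm_num) le_rfl, shannonH_eq]
            exact div_nonneg (Real.binEntropy_nonneg (by norm_num) (by norm_num))
              (Real.log_nonneg one_le_two)
          linarith [hE (m + (k + 1)) n]
        · have h0 : 0 ≤ clampedH (predictionError (P n) k) := by
            rw [clampedH_eq (hG0 _ _) (hG1 _ _), shannonH_eq]
            exact div_nonneg (Real.binEntropy_nonneg (hG0 _ _) ((hG1 _ _).trans (by norm_num)))
              (Real.log_nonneg one_le_two)
          have h1 := monotone_clampedH (hG1 k n)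
          rw [abs_of_nonneg (by positivity)]
          linarith
        · rw [clampedH_eq (hG0 _ _) (hG1 _ _), show m + (k + 1) = k + (m + 1) by ring]
          exact (hP n).entropyRate_add_le k m
      have h2 : Tendsto (fun m : ℕ => k / (k + ((m : ℝ) + 1)) + clampedH (G k)) atTop
          (𝓝 (0 + clampedH (G k))) :=
        (tendsto_const_nhds.div_atTop (tendsto_atTop_add_const_left _ _
          (tendsto_atTop_add_const_right _ _ tendsto_natCast_atTop_atTop))).add_const _
      rw [zero_add] at h2
      exact le_of_tendsto_of_tendsto' ((tendsto_add_atTop_iff_nat (k + 1)).2 hElim) h2 h1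
    have h3 := ge_of_tendsto' ((continuous_clampedH.tendsto _).comp hGlim) hH
    rwa [clampedH_eq (ge_of_tendsto' hGlim hGnonneg) (le_of_tendsto' hGlim hGhalf)] at h3

theorem rauzy_bounds (x : BinSeq) :
    (Tendsto (fun l : ℕ => gammaLowerAt l x) atTop (𝓝 (gammaLower x)) ∧
      Tendsto (fun l : ℕ => gammaUpperAt l x) atTop (𝓝 (gammaUpper x)) ∧
      Tendsto (fun l : ℕ => betaLowerAt l x) atTop (𝓝 (betaLower x)) ∧
      Tendsto (fun l : ℕ => betaUpperAt l x) atTop (𝓝 (betaUpper x)) ∧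
      Tendsto (fun l : ℕ => hLowerAt l x) atTop (𝓝 (hLower x)) ∧
      Tendsto (fun l : ℕ => hUpperAt l x) atTop (𝓝 (hUpper x))) ∧
    (2 * gammaLower x ≤ hLower x ∧ hLower x ≤ shannonH (gammaLower x)) ∧
    (2 * gammaUpper x ≤ hUpper x ∧ hUpper x ≤ shannonH (gammaUpper x)) ∧
    (2 * betaLower x ≤ hLower x ∧ hLower x ≤ shannonH (betaLower x)) ∧
    (2 * betaUpper x ≤ hUpper x ∧ hUpper x ≤ shannonH (betaUpper x)) := by
  have hP := stationary_cyclicWeight x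
  have hR := fun n => (hP n).reversal
  have hf := tendsto_prefixWeight_sub_cyclicWeight x
  have hγ := tendsto_gammaWord_sub hf
  have hβ := tendsto_betaWord_sub hf
  have hh := tendsto_blockEntropyWord_sub hP hf
  have hh' : ∀ l, Tendsto (fun n => blockEntropyWord l (pre x n) -
      entropyRate (reversal (cyclicWeight x n)) l) atTop (𝓝 0) := by
    simpa only [entropyRate, wordEntropy_reversal] using hh
  obtain ⟨g1, e1, hg1, he1, a1, b1⟩ := limitLike_liminf.entropy_bounds hP hγ hh
  obtain ⟨g2, e2, hg2, he2, a2, b2⟩ := limitLike_limsup.entropy_bounds hP hγ hh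
  obtain ⟨g3, e3, hg3, he3, a3, b3⟩ := limitLike_liminf.entropy_bounds hR hβ hh'
  obtain ⟨g4, e4, hg4, he4, a4, b4⟩ := limitLike_limsup.entropy_bounds hR hβ hh'
  -- The process and its reversal have the same block entropies, so the limits obtained with `γ` and
  -- with `β` agree.
  obtain rfl := tendsto_nhds_unique he1 he3
  obtain rfl := tendsto_nhds_unique he2 he4
  have t1 : gammaLower x = g1 := Tendsto.limUnder_eq hg1
  have t2 : gammaUpper x = g2 := Tendsto.limUnder_eq hg2
  have t3 : betaLower x = g3 := Tendsto.limUnder_eq hg3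
  have t4 : betaUpper x = g4 := Tendsto.limUnder_eq hg4
  have t5 : hLower x = e1 := Tendsto.limUnder_eq he1
  have t6 : hUpper x = e2 := Tendsto.limUnder_eq he2
  rw [t1, t2, t3, t4, t5, t6]
  exact ⟨⟨hg1, hg2, hg3, hg4, he1, he2⟩, ⟨a1, b1⟩, ⟨a2, b2⟩, ⟨a3, b3⟩, ⟨a4, b4⟩⟩

/-! ### Independent symbols with periodic law, averaged over the phase -/

/-- The probability of the symbol `c` when `0` has probability `t`. -/
def symbolWeight (t : ℝ) (c : Bool) : ℝ := if c = false then t else 1 - t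

/-- The word weights of independent symbols, the symbol at position `j` being `0` with probability
`θ (r + j)`. -/
def phaseWeight {q : ℕ} (θ : ZMod q → ℝ) (r : ZMod q) : WordWeight :=
  fun l u => ∏ j : Fin l, symbolWeight (θ (r + ((j : ℕ) : ZMod q))) (u j)

/-- The average of `phaseWeight θ r` over all phases `r`. -/
noncomputable def periodicWeight {q : ℕ} [NeZero q] (θ : ZMod q → ℝ) : WordWeight :=
  fun l u => (∑ r, phaseWeight θ r l u) / q

theorem symbolWeight_nonneg {t : ℝ} (ht : t ∈ Set.Icc (0 : ℝ) 1) (c : Bool) :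
    0 ≤ symbolWeight t c := by
  rw [symbolWeight]
  split_ifs
  · exact ht.1
  · linarith [ht.2]

section phases

variable {q : ℕ} {θ : ZMod q → ℝ}

theorem phaseWeight_snoc (r : ZMod q) {l : ℕ} (v : Word l) (c : Bool) :
    phaseWeight θ r (l + 1) (snocWord v c) =
      phaseWeight θ r l v * symbolWeight (θ (r + (l : ZMod q))) c := by
  simp [phaseWeight, Fin.prod_univ_castSucc]

theorem phaseWeight_cons (r : ZMod q) {l : ℕ} (v : Word l) (c : Bool) :
    phaseWeight θ r (l + 1) (consWord c v) =
      symbolWeight (θ r) c * phaseWeight θ (r + 1) l v := by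
  simp [phaseWeight, Fin.prod_univ_succ, add_assoc, add_comm (1 : ZMod q)]

theorem phaseWeight_nonneg (hθ : ∀ s, θ s ∈ Set.Icc (0 : ℝ) 1) (r : ZMod q) (l : ℕ) (u : Word l) :
    0 ≤ phaseWeight θ r l u :=
  Finset.prod_nonneg fun _ _ => symbolWeight_nonneg (hθ _) _

theorem sum_phaseWeight (r : ZMod q) (l : ℕ) : ∑ u, phaseWeight θ r l u = 1 := by
  induction l with
  | zero => simp [phaseWeight]
  | succ l ih =>
    rw [sum_word_snoc, ← ih]
    refine Finset.sum_congr rfl fun v _ => ?_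
    rw [phaseWeight_snoc, phaseWeight_snoc]
    simp only [symbolWeight]
    simp
    ring

theorem sum_phase_add [NeZero q] {M : Type*} [AddCommMonoid M] (F : ZMod q → M) (s : ZMod q) :
    ∑ r, F (r + s) = ∑ r, F r :=
  Equiv.sum_comp (Equiv.addRight s) F

theorem stationary_periodicWeight [NeZero q] (hθ : ∀ s, θ s ∈ Set.Icc (0 : ℝ) 1) :
    Stationary (periodicWeight θ) where
  nonneg l u := div_nonneg (Finset.sum_nonneg fun r _ => phaseWeight_nonneg hθ r l u)
    q.cast_nonneg
  empty u := by simp [periodicWeight, phaseWeight, ZMod.card, NeZero.ne]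
  snoc l v := by
    simp only [periodicWeight]
    rw [← add_div, ← Finset.sum_add_distrib]
    congr 1
    refine Finset.sum_congr rfl fun r _ => ?_
    rw [phaseWeight_snoc, phaseWeight_snoc]
    simp [symbolWeight]
    ring
  cons l v := by
    simp only [periodicWeight]
    rw [← add_div, ← Finset.sum_add_distrib]
    congr 1
    rw [← sum_phase_add (fun r => phaseWeight θ r l v) 1]
    refine Finset.sum_congr rfl fun r _ => ?_
    rw [phaseWeight_cons, phaseWeight_cons]
    simp [symbolWeight]
    ring

theorem reversal_periodicWeight [NeZero q] :
    reversal (periodicWeight θ) = periodicWeight fun s => θ (-s) := by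
  funext l u
  simp only [reversal, periodicWeight]
  congr 1
  -- A word that starts in phase `1 - l - r` has its symbol at position `l - 1 - j` in phase `-(r +
  -- j)`.
  rw [← Equiv.sum_comp (Equiv.subLeft (1 - (l : ZMod q)))]
  refine Finset.sum_congr rfl fun r _ => ?_
  simp only [phaseWeight]
  rw [← Equiv.prod_comp Fin.revPerm]
  refine Finset.prod_congr rfl fun j _ => ?_
  have hj : ((j.rev : ℕ) : ZMod q) = l - 1 - (j : ℕ) := by
    rw [Fin.val_rev, Nat.cast_sub (by omega)]
    push_cast
    ring
  simp only [Equiv.subLeft_apply, Fin.revPerm_apply, Function.comp, Fin.rev_rev, hj]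
  congr 2
  ring

/-- A predictor that is told the phase errs with probability `min θ (1 - θ)`, and the extra
information can only help. -/
theorem average_min_le_predictionError [NeZero q] (hθ : ∀ s, θ s ∈ Set.Icc (0 : ℝ) 1) (l : ℕ) :
    (∑ s, min (θ s) (1 - θ s)) / q ≤ predictionError (periodicWeight θ) l := by
  have hq : (0 : ℝ) ≤ q := q.cast_nonneg
  have h1 : ∑ s, min (θ s) (1 - θ s) = ∑ v : Word l, ∑ r,
      phaseWeight θ r l v * min (θ (r + l)) (1 - θ (r + l)) := by
    rw [Finset.sum_comm, ← sum_phase_add _ (l : ZMod q)]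
    refine Finset.sum_congr rfl fun r _ => ?_
    rw [← Finset.sum_mul, sum_phaseWeight, one_mul]
  rw [h1, predictionError, contextSum, Finset.sum_div]
  refine Finset.sum_le_sum fun v _ => ?_
  simp only [periodicWeight]
  rw [min_div_div_right hq]
  refine div_le_div_of_nonneg_right (le_min ?_ ?_) hq
  · refine Finset.sum_le_sum fun r _ => ?_
    rw [phaseWeight_snoc]
    exact mul_le_mul_of_nonneg_left (min_le_left _ _) (phaseWeight_nonneg hθ _ _ _)
  · refine Finset.sum_le_sum fun r _ => ?_
    rw [phaseWeight_snoc]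
    exact mul_le_mul_of_nonneg_left (min_le_right _ _) (phaseWeight_nonneg hθ _ _ _)

/-- The prediction that is `1` as soon as a `1` has been seen in the same phase. -/
def phasePrediction (q : ℕ) {l : ℕ} (v : Word l) : Bool :=
  decide (∃ j : Fin l, q ∣ (j : ℕ) ∧ v j = true)

theorem prod_dvd_le [NeZero q] {t : ℝ} (h0 : 0 ≤ t) (h1 : t ≤ 1 / 2) (M : ℕ) :
    ∏ j ∈ Finset.range (M * q), (if q ∣ j then t else 1) ≤ (1 / 2) ^ M := by
  have hq := NeZero.pos q
  have hnn : ∀ j : ℕ, 0 ≤ if q ∣ j then t else 1 := fun j => by split_ifs <;> linarith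
  induction M with
  | zero => simp
  | succ M ih =>
    rw [add_mul, one_mul, Finset.prod_range_add, pow_succ]
    refine mul_le_mul ih ?_ (Finset.prod_nonneg fun j _ => hnn _) (by positivity)
    have h2 : ∀ j ∈ Finset.range q, (if q ∣ M * q + j then t else 1) = if j = 0 then t else 1 := by
      intro j hj
      have hj' := Finset.mem_range.1 hj
      have : q ∣ M * q + j ↔ j = 0 := by
        rw [Nat.dvd_add_right (Dvd.intro_left M rfl)]
        exact ⟨fun h => Nat.eq_zero_of_dvd_of_lt h hj', fun h => h ▸ dvd_zero q⟩
      simp [this]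
    rw [Finset.prod_congr rfl h2, Finset.prod_ite_eq' , if_pos (Finset.mem_range.2 hq)]
    exact h1

/-- The event that no `1` has appeared in phase `r` is an intersection of conditions on single
positions, so by independence its probability is a product. -/
theorem sum_phaseWeight_avoiding [NeZero q] (r : ZMod q) (l : ℕ) :
    ∑ v : Word l, phaseWeight θ r l v * (if phasePrediction q v then 0 else 1) =
      ∏ j ∈ Finset.range l, if q ∣ j then θ r else 1 := by
  rw [← Fin.prod_univ_eq_prod_range fun j => if q ∣ j then θ r else 1]
  have h1 : ∀ j : Fin l, (if q ∣ (j : ℕ) then θ r else 1) =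
      ∑ c : Bool, symbolWeight (θ (r + ((j : ℕ) : ZMod q))) c *
        (if q ∣ (j : ℕ) ∧ c = true then 0 else 1) := by
    intro j
    by_cases h : q ∣ (j : ℕ)
    · simp [h, (ZMod.natCast_eq_zero_iff _ _).2 h, symbolWeight]
    · simp [h, symbolWeight]
  simp only [h1]
  rw [Finset.prod_univ_sum, Fintype.piFinset_univ]
  refine Finset.sum_congr rfl fun v _ => ?_
  rw [Finset.prod_mul_distrib, phaseWeight]
  congr 1
  by_cases h : ∃ j : Fin l, q ∣ (j : ℕ) ∧ v j = true
  · obtain ⟨j, hj⟩ := h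
    rw [Finset.prod_eq_zero (Finset.mem_univ j), if_pos]
    · exact decide_eq_true ⟨j, hj⟩
    · exact if_pos hj
  · rw [if_neg (by simpa [phasePrediction] using h), Finset.prod_eq_one]
    exact fun j _ => if_neg fun hj => h ⟨j, hj⟩

/-- If `θ r = 1` the phase never shows a `1` and the prediction `0` is always right. If `θ r ≤ 1/2`
the best prediction is `1`, and it is made unless all `M` earlier symbols of the phase were `0`. -/
theorem phase_error_le [NeZero q] (hθ : ∀ s, θ s ∈ Set.Icc (0 : ℝ) (1 / 2) ∨ θ s = 1)
    (hθ' : ∀ s, θ s ∈ Set.Icc (0 : ℝ) 1) (r : ZMod q) (M : ℕ) :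
    ∑ v : Word (M * q), phaseWeight θ r _ v * symbolWeight (θ r) (!phasePrediction q v) ≤
      min (θ r) (1 - θ r) + (1 / 2) ^ M := by
  rcases hθ r with h | h
  · rw [min_eq_left (by linarith [h.2])]
    have h1 : ∀ v : Word (M * q), phaseWeight θ r _ v * symbolWeight (θ r) (!phasePrediction q v) ≤
        phaseWeight θ r _ v * θ r +
          phaseWeight θ r _ v * (if phasePrediction q v then 0 else 1) := by
      intro v
      rw [← mul_add]
      refine mul_le_mul_of_nonneg_left ?_ (phaseWeight_nonneg hθ' _ _ _)
      cases phasePrediction q v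
      · simp [symbolWeight]
        linarith [h.1]
      · simp [symbolWeight]
    refine (Finset.sum_le_sum fun v _ => h1 v).trans ?_
    rw [Finset.sum_add_distrib, ← Finset.sum_mul, sum_phaseWeight, one_mul,
      sum_phaseWeight_avoiding]
    exact add_le_add_right (prod_dvd_le h.1 h.2 M) _
  · rw [Finset.sum_eq_zero]
    · rw [h]
      norm_num
    intro v _
    by_cases hv : ∃ j : Fin (M * q), q ∣ (j : ℕ) ∧ v j = true
    · obtain ⟨j, hj, hjv⟩ := hv
      rw [phaseWeight, Finset.prod_eq_zero (Finset.mem_univ j), zero_mul]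
      simp [(ZMod.natCast_eq_zero_iff _ _).2 hj, hjv, symbolWeight, h]
    · have : phasePrediction q v = false := by simpa [phasePrediction] using hv
      simp [this, symbolWeight, h]

theorem predictionError_mul_le [NeZero q] (hθ : ∀ s, θ s ∈ Set.Icc (0 : ℝ) (1 / 2) ∨ θ s = 1)
    (hθ' : ∀ s, θ s ∈ Set.Icc (0 : ℝ) 1) (M : ℕ) :
    predictionError (periodicWeight θ) (M * q) ≤
      (∑ s, min (θ s) (1 - θ s)) / q + (1 / 2) ^ M := by
  have hq : (0 : ℝ) < q := by exact_mod_cast NeZero.pos q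
  have h1 : predictionError (periodicWeight θ) (M * q) ≤
      ∑ v : Word (M * q), periodicWeight θ _ (snocWord v (!phasePrediction q v)) := by
    refine Finset.sum_le_sum fun v _ => ?_
    cases phasePrediction q v
    · exact min_le_right _ _
    · exact min_le_left _ _
  refine h1.trans ?_
  simp only [periodicWeight, ← Finset.sum_div]
  rw [Finset.sum_comm, div_add' _ _ _ hq.ne']
  refine div_le_div_of_nonneg_right ?_ hq.le
  have h2 : (1 / 2 : ℝ) ^ M * q = ∑ _s : ZMod q, (1 / 2 : ℝ) ^ M := by
    simp [ZMod.card, mul_comm]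
  rw [h2, ← Finset.sum_add_distrib]
  refine Finset.sum_le_sum fun r _ => (le_of_eq ?_).trans (phase_error_le hθ hθ' r M)
  refine Finset.sum_congr rfl fun v _ => ?_
  -- The context length is a multiple of `q`, so the predicted symbol is in the phase `r` in which
  -- the context starts.
  rw [phaseWeight_snoc]
  simp

theorem tendsto_predictionError_periodicWeight [NeZero q]
    (hθ : ∀ s, θ s ∈ Set.Icc (0 : ℝ) (1 / 2) ∨ θ s = 1) (hθ' : ∀ s, θ s ∈ Set.Icc (0 : ℝ) 1) :
    Tendsto (predictionError (periodicWeight θ)) atTop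
      (𝓝 ((∑ s, min (θ s) (1 - θ s)) / q)) := by
  have hanti : Antitone (predictionError (periodicWeight θ)) :=
    antitone_nat_of_succ_le (stationary_periodicWeight hθ').predictionError_succ_le
  have h1 : Tendsto (fun l : ℕ => (∑ s, min (θ s) (1 - θ s)) / q + (1 / 2 : ℝ) ^ (l / q)) atTop
      (𝓝 ((∑ s, min (θ s) (1 - θ s)) / q + 0)) :=
    tendsto_const_nhds.add ((tendsto_pow_atTop_nhds_zero_of_lt_one (by norm_num)
      (by norm_num)).comp (Nat.tendsto_div_const_atTop (NeZero.ne q)))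
  rw [add_zero] at h1
  exact tendsto_of_tendsto_of_tendsto_of_le_of_le tendsto_const_nhds h1
    (average_min_le_predictionError hθ')
    fun l => (hanti (Nat.div_mul_le_self l q)).trans (predictionError_mul_le hθ hθ' _)

theorem wordEntropy_phaseWeight (r : ZMod q) (l : ℕ) :
    wordEntropy (phaseWeight θ r) l =
      ∑ j ∈ Finset.range l, Real.binEntropy (θ (r + (j : ZMod q))) := by
  induction l with
  | zero => simp [wordEntropy, phaseWeight]
  | succ l ih =>
    rw [Finset.sum_range_succ, ← ih, wordEntropy, sum_word_snoc, wordEntropy,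
      ← one_mul (Real.binEntropy _), ← sum_phaseWeight (θ := θ) r l, Finset.sum_mul,
      ← Finset.sum_add_distrib]
    refine Finset.sum_congr rfl fun v _ => ?_
    rw [phaseWeight_snoc, phaseWeight_snoc, Real.negMulLog_mul, Real.negMulLog_mul,
      Real.binEntropy_eq_negMulLog_add_negMulLog_one_sub]
    simp only [symbolWeight, if_true, Bool.true_eq_false, if_false]
    ring

theorem sum_wordEntropy_phaseWeight [NeZero q] (l : ℕ) :
    ∑ r, wordEntropy (phaseWeight θ r) l = l * ∑ s, Real.binEntropy (θ s) := by
  simp only [wordEntropy_phaseWeight]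
  rw [Finset.sum_comm]
  simp [sum_phase_add fun s => Real.binEntropy (θ s)]

theorem negMulLog_sum_le {ι : Type*} [Fintype ι] {a : ι → ℝ} (ha : ∀ i, 0 ≤ a i) :
    Real.negMulLog (∑ i, a i) ≤ ∑ i, Real.negMulLog (a i) := by
  rw [Real.negMulLog, neg_mul, Finset.sum_mul, ← Finset.sum_neg_distrib]
  refine Finset.sum_le_sum fun i _ => ?_
  rcases (ha i).eq_or_lt with h | h
  · simp [← h]
  · rw [Real.negMulLog, neg_mul]
    exact neg_le_neg (mul_le_mul_of_nonneg_left
      (Real.log_le_log h (Finset.single_le_sum (fun j _ => ha j) (Finset.mem_univ i))) h.le)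

/-- Entropy is concave, so a mixture has at least the mean entropy of its components. -/
theorem le_wordEntropy_periodicWeight [NeZero q] (hθ : ∀ s, θ s ∈ Set.Icc (0 : ℝ) 1) (l : ℕ) :
    l * ((∑ s, Real.binEntropy (θ s)) / q) ≤ wordEntropy (periodicWeight θ) l := by
  have hq : (0 : ℝ) < q := by exact_mod_cast NeZero.pos q
  rw [← mul_div_assoc, ← sum_wordEntropy_phaseWeight]
  simp only [wordEntropy]
  rw [Finset.sum_comm, Finset.sum_div]
  refine Finset.sum_le_sum fun u _ => ?_
  have := Real.concaveOn_negMulLog.le_map_sum (t := Finset.univ) (w := fun _ : ZMod q => 1 / (q : ℝ))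
    (p := fun r => phaseWeight θ r l u) (fun _ _ => by positivity)
    (by simp [ZMod.card, hq.ne']) (fun r _ => phaseWeight_nonneg hθ r l u)
  simp only [smul_eq_mul, ← Finset.mul_sum] at this
  rwa [one_div_mul_eq_div, one_div_mul_eq_div] at this

/-- The entropy of the word is at most that of the pair of word and phase, and a uniform phase has
entropy `log q`. -/
theorem wordEntropy_periodicWeight_le [NeZero q] (hθ : ∀ s, θ s ∈ Set.Icc (0 : ℝ) 1) (l : ℕ) :
    wordEntropy (periodicWeight θ) l ≤
      l * ((∑ s, Real.binEntropy (θ s)) / q) + Real.log q := by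
  have hq : (0 : ℝ) < q := by exact_mod_cast NeZero.pos q
  have h1 : ∀ u : Word l, Real.negMulLog (periodicWeight θ l u) ≤
      (∑ r, Real.negMulLog (phaseWeight θ r l u)) / q +
        (∑ r, phaseWeight θ r l u) * (Real.log q / q) := by
    intro u
    rw [periodicWeight, Finset.sum_div]
    refine (negMulLog_sum_le fun r => div_nonneg (phaseWeight_nonneg hθ r l u) hq.le).trans
      (le_of_eq ?_)
    rw [Finset.sum_div, Finset.sum_mul, ← Finset.sum_add_distrib]
    refine Finset.sum_congr rfl fun r _ => ?_
    rw [div_eq_mul_inv, Real.negMulLog_mul,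
      show Real.negMulLog (q : ℝ)⁻¹ = -(q : ℝ)⁻¹ * Real.log (q : ℝ)⁻¹ from rfl, Real.log_inv]
    ring
  refine (Finset.sum_le_sum fun u _ => h1 u).trans (le_of_eq ?_)
  rw [Finset.sum_add_distrib, ← Finset.sum_div, ← Finset.sum_mul, Finset.sum_comm,
    Finset.sum_comm (f := fun u r => phaseWeight θ r l u)]
  simp only [sum_phaseWeight]
  have := sum_wordEntropy_phaseWeight (θ := θ) l
  simp only [wordEntropy] at this
  rw [this]
  simp [ZMod.card]
  field_simp

theorem tendsto_entropyRate_periodicWeight [NeZero q] (hθ : ∀ s, θ s ∈ Set.Icc (0 : ℝ) 1) :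
    Tendsto (entropyRate (periodicWeight θ)) atTop (𝓝 ((∑ s, shannonH (θ s)) / q)) := by
  have hlog : 0 < Real.log 2 := Real.log_pos one_lt_two
  have e : (∑ s, shannonH (θ s)) / q = (∑ s, Real.binEntropy (θ s)) / q / Real.log 2 := by
    simp only [shannonH_eq]
    rw [← Finset.sum_div, div_right_comm]
  rw [e]
  refine Tendsto.div_const ?_ _
  have h1 : Tendsto (fun l : ℕ => (∑ s, Real.binEntropy (θ s)) / q + Real.log q / l) atTop
      (𝓝 ((∑ s, Real.binEntropy (θ s)) / q + 0)) :=
    tendsto_const_nhds.add (tendsto_const_nhds.div_atTop tendsto_natCast_atTop_atTop)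
  rw [add_zero] at h1
  refine tendsto_of_tendsto_of_tendsto_of_le_of_le' tendsto_const_nhds h1 ?_ ?_
  · filter_upwards [eventually_gt_atTop 0] with l hl
    have hl' : (0 : ℝ) < l := by exact_mod_cast hl
    rw [le_div_iff₀ hl', mul_comm]
    exact le_wordEntropy_periodicWeight hθ l
  · filter_upwards [eventually_gt_atTop 0] with l hl
    have hl' : (0 : ℝ) < l := by exact_mod_cast hl
    rw [div_le_iff₀ hl', add_mul, div_mul_cancel₀ _ hl'.ne', mul_comm _ (l : ℝ)]
    exact wordEntropy_periodicWeight_le hθ l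

end phases

/-! ### Sequences with the frequencies of a periodic law -/

/-- Each word occurs in `x` with the frequency that `P` prescribes. -/
def HasFrequencies (x : BinSeq) (P : WordWeight) : Prop :=
  ∀ (l : ℕ) (u : Word l), Tendsto (fun n : ℕ => (occ (pre x n) u : ℝ) / n) atTop (𝓝 (P l u))

theorem HasFrequencies.tendsto_sub {x : BinSeq} {P : WordWeight} (h : HasFrequencies x P) (l : ℕ)
    (u : Word l) : Tendsto (fun n => prefixWeight x n l u - P l u) atTop (𝓝 0) := by
  rw [← sub_self (P l u)]
  refine Tendsto.sub_const ?_ _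
  have h1 := (h l u).mul (tendsto_natCast_div_add_atTop (1 - (l : ℝ)))
  rw [mul_one] at h1
  refine h1.congr' ?_
  filter_upwards [eventually_gt_atTop 0] with n hn
  have hn' : (n : ℝ) ≠ 0 := by positivity
  rw [prefixWeight, freq, div_mul_div_cancel₀ hn', show (n : ℝ) + (1 - l) = n - l + 1 by ring]

theorem HasFrequencies.limits {x : BinSeq} {q : ℕ} [NeZero q] {θ : ZMod q → ℝ}
    (h : HasFrequencies x (periodicWeight θ)) (hθ : ∀ s, θ s ∈ Set.Icc (0 : ℝ) (1 / 2) ∨ θ s = 1) :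
    gammaLower x = (∑ s, min (θ s) (1 - θ s)) / q ∧
      gammaUpper x = (∑ s, min (θ s) (1 - θ s)) / q ∧
      betaLower x = (∑ s, min (θ s) (1 - θ s)) / q ∧
      betaUpper x = (∑ s, min (θ s) (1 - θ s)) / q ∧
      hLower x = (∑ s, shannonH (θ s)) / q ∧ hUpper x = (∑ s, shannonH (θ s)) / q := by
  have hθ' : ∀ s, θ s ∈ Set.Icc (0 : ℝ) 1 := by
    intro s
    rcases hθ s with h | h
    · exact ⟨h.1, h.2.trans (by norm_num)⟩
    · rw [h]
      simp
  have hsub := h.tendsto_sub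
  have hγ : ∀ l, Tendsto (fun n => gammaWord l (pre x n)) atTop
      (𝓝 (predictionError (periodicWeight θ) l)) := fun l => by
    simpa using (tendsto_gammaWord_sub (P := fun _ => periodicWeight θ) hsub l).add_const
      (predictionError (periodicWeight θ) l)
  have hβ : ∀ l, Tendsto (fun n => betaWord l (pre x n)) atTop
      (𝓝 (predictionError (periodicWeight fun s => θ (-s)) l)) := fun l => by
    rw [← reversal_periodicWeight]
    simpa using (tendsto_betaWord_sub (P := fun _ => periodicWeight θ) hsub l).add_const
      (predictionError (reversal (periodicWeight θ)) l)
  have hh : ∀ l, Tendsto (fun n => blockEntropyWord l (pre x n)) atTop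
      (𝓝 (entropyRate (periodicWeight θ) l)) := fun l => by
    simpa [entropyRate] using (tendsto_blockEntropyWord_sub (P := fun _ => periodicWeight θ)
      (fun _ => stationary_periodicWeight hθ') hsub l).add_const (entropyRate (periodicWeight θ) l)
  have tγ := tendsto_predictionError_periodicWeight hθ hθ'
  have tβ := tendsto_predictionError_periodicWeight (θ := fun s => θ (-s)) (fun s => hθ _)
    (fun s => hθ' _)
  -- Reversal only permutes the phases, so `β` and `γ` have the same limit.
  have hneg : ∑ s, min (θ (-s)) (1 - θ (-s)) = ∑ s, min (θ s) (1 - θ s) :=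
    Equiv.sum_comp (Equiv.neg (ZMod q)) fun s => min (θ s) (1 - θ s)
  rw [hneg] at tβ
  have th := tendsto_entropyRate_periodicWeight hθ'
  refine ⟨?_, ?_, ?_, ?_, ?_, ?_⟩
  · exact Tendsto.limUnder_eq (tγ.congr fun l => (hγ l).liminf_eq.symm)
  · exact Tendsto.limUnder_eq (tγ.congr fun l => (hγ l).limsup_eq.symm)
  · exact Tendsto.limUnder_eq (tβ.congr fun l => (hβ l).liminf_eq.symm)
  · exact Tendsto.limUnder_eq (tβ.congr fun l => (hβ l).limsup_eq.symm)
  · exact Tendsto.limUnder_eq (th.congr fun l => (hh l).liminf_eq.symm)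
  · exact Tendsto.limUnder_eq (th.congr fun l => (hh l).limsup_eq.symm)

/-! ### Almost sure word frequencies -/

-- Windows of length `l ≤ d` that start `d` apart are disjoint, hence independent, and periodicity
-- gives them a common law. The strong law then applies; it needs only pairwise independence.
open MeasureTheory ProbabilityTheory in
theorem ae_tendsto_block_frequency {Ω : Type*} [MeasurableSpace Ω] {μ : Measure Ω}
    [IsProbabilityMeasure μ] {X : ℕ → Ω → Bool} (hX : ∀ n, Measurable (X n))
    (hind : iIndepFun X μ) {t : ℕ → ℝ} (ht : ∀ n c, (μ.map (X n)).real {c} = symbolWeight (t n) c)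
    {d : ℕ} (hper : ∀ n m, t (n + d * m) = t n) {l : ℕ} (hl : l ≤ d) (u : Word l) (r : ℕ) :
    ∀ᵐ ω ∂μ, Tendsto (fun M : ℕ => (∑ m ∈ Finset.range M,
      if window (fun n => X n ω) l (r + d * m) = u then (1 : ℝ) else 0) / M) atTop
      (𝓝 (∏ j : Fin l, symbolWeight (t (r + j)) (u j))) := by
  set W : ℕ → Ω → Word l := fun m ω => window (fun n => X n ω) l (r + d * m) with hW
  have hWm : ∀ m, Measurable (W m) := fun m => measurable_pi_lambda _ fun j => hX _
  have hlaw : ∀ m w, (μ.map (W m)).real {w} = ∏ j : Fin l, symbolWeight (t (r + j)) (w j) := by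
    intro m w
    have hinj : Function.Injective fun j : Fin l => r + d * m + (j : ℕ) := fun a b hab =>
      Fin.ext (Nat.add_left_cancel hab)
    have h1 := (iIndepFun_iff_map_fun_eq_pi_map (fun j => (hX _).aemeasurable)).1
      (hind.precomp hinj)
    have h2 : μ.map (W m) = Measure.pi fun j : Fin l => μ.map (X (r + d * m + j)) := h1
    have : ∀ n, IsProbabilityMeasure (μ.map (X n)) := fun n =>
      Measure.isProbabilityMeasure_map (hX n).aemeasurable
    rw [h2, Measure.real, Measure.pi_singleton, ENNReal.toReal_prod]
    refine Finset.prod_congr rfl fun j _ => ?_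
    have h3 := ht (r + d * m + j) (w j)
    rw [Measure.real] at h3
    rw [h3, add_right_comm, hper]
  have hindW : ∀ m m', m ≠ m' → IndepFun (W m) (W m') μ := by
    intro m m' hne
    set S : ℕ → Finset ℕ := fun m => Finset.univ.image fun j : Fin l => r + d * m + (j : ℕ)
    have hdisj : Disjoint (S m) (S m') := by
      rw [Finset.disjoint_left]
      intro i hi hi'
      obtain ⟨j, -, hj⟩ := Finset.mem_image.1 hi
      obtain ⟨j', -, hj'⟩ := Finset.mem_image.1 hi'
      have h1 : d * m + j = d * m' + j' := by omega
      have h2 : (j : ℕ) < d := j.2.trans_le hl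
      have h3 : (j' : ℕ) < d := j'.2.trans_le hl
      have hd : 0 < d := by omega
      apply hne
      have h4 := congrArg (· / d) h1
      simpa [Nat.mul_add_div hd, Nat.div_eq_of_lt h2, Nat.div_eq_of_lt h3] using h4
    have hmem : ∀ m (j : Fin l), r + d * m + (j : ℕ) ∈ S m := fun m j =>
      Finset.mem_image_of_mem _ (Finset.mem_univ j)
    exact (hind.indepFun_finset (S m) (S m') hdisj hX).comp
      (φ := fun (h : S m → Bool) (j : Fin l) => h ⟨_, hmem m j⟩)
      (ψ := fun (h : S m' → Bool) (j : Fin l) => h ⟨_, hmem m' j⟩)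
      (measurable_of_finite _) (measurable_of_finite _)
  set F : Word l → ℝ := fun w => if w = u then 1 else 0 with hF
  have hFm : Measurable F := measurable_of_finite _
  have hident : ∀ m, IdentDistrib (W m) (W 0) μ μ := by
    intro m
    refine ⟨(hWm m).aemeasurable, (hWm 0).aemeasurable, ?_⟩
    have := Measure.isProbabilityMeasure_map (μ := μ) (hWm m).aemeasurable
    have := Measure.isProbabilityMeasure_map (μ := μ) (hWm 0).aemeasurable
    refine Measure.ext_of_singleton fun w => ?_
    have h := (hlaw m w).trans (hlaw 0 w).symm
    rwa [Measure.real, Measure.real, ENNReal.toReal_eq_toReal_iff' (measure_ne_top _ _)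
      (measure_ne_top _ _)] at h
  have hmean : ∫ ω, F (W 0 ω) ∂μ = ∏ j : Fin l, symbolWeight (t (r + j)) (u j) := by
    rw [← hlaw 0 u, map_measureReal_apply (hWm 0) (measurableSet_singleton u),
      ← integral_indicator_one ((hWm 0) (measurableSet_singleton u))]
    refine integral_congr_ae (Eventually.of_forall fun ω => ?_)
    by_cases h : W 0 ω = u
    · rw [Set.indicator_of_mem (show ω ∈ W 0 ⁻¹' {u} from h)]
      simp [hF, h]
    · rw [Set.indicator_of_notMem (show ω ∉ W 0 ⁻¹' {u} from h)]
      simp [hF, h]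
  have hint : Integrable (fun ω => F (W 0 ω)) μ := by
    refine Integrable.of_bound (hFm.comp (hWm 0)).aestronglyMeasurable 1
      (Eventually.of_forall fun ω => ?_)
    simp only [hF]
    split_ifs <;> simp
  have key := strong_law_ae_real (fun m ω => F (W m ω)) hint
    (fun m m' hne => (hindW m m' hne).comp hFm hFm) fun m => (hident m).comp hFm
  rwa [hmean] at key

theorem sum_range_mul_eq (g : ℕ → ℝ) (d M : ℕ) :
    ∑ i ∈ Finset.range (d * M), g i =
      ∑ r ∈ Finset.range d, ∑ m ∈ Finset.range M, g (r + d * m) := by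
  induction M with
  | zero => simp
  | succ M ih =>
    simp only [Finset.sum_range_succ, Finset.sum_add_distrib]
    rw [mul_add, mul_one, Finset.sum_range_add, ih]
    simp only [add_comm]

theorem tendsto_cesaro_of_residues {g : ℕ → ℝ} (h0 : ∀ i, 0 ≤ g i) (h1 : ∀ i, g i ≤ 1) {d : ℕ}
    (hd : 0 < d) {c : ℕ → ℝ}
    (h : ∀ r < d, Tendsto (fun M : ℕ => (∑ m ∈ Finset.range M, g (r + d * m)) / M) atTop
      (𝓝 (c r))) :
    Tendsto (fun N : ℕ => (∑ i ∈ Finset.range N, g i) / N) atTop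
      (𝓝 ((∑ r ∈ Finset.range d, c r) / d)) := by
  have hd' : (0 : ℝ) < d := by exact_mod_cast hd
  have hdiv : Tendsto (fun N : ℕ => N / d) atTop atTop := Nat.tendsto_div_const_atTop hd.ne'
  have hzero : ∀ a : ℕ → ℝ, (∀ N, 0 ≤ a N) → (∀ N, a N ≤ d) →
      Tendsto (fun N : ℕ => a N / N) atTop (𝓝 0) := fun a ha ha' =>
    squeeze_zero (fun N => div_nonneg (ha N) N.cast_nonneg)
      (fun N => div_le_div_of_nonneg_right (ha' N) N.cast_nonneg)
      (tendsto_const_nhds.div_atTop tendsto_natCast_atTop_atTop)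
  have hblocks : Tendsto (fun M : ℕ => (∑ i ∈ Finset.range (d * M), g i) / M) atTop
      (𝓝 (∑ r ∈ Finset.range d, c r)) := by
    simp only [sum_range_mul_eq, Finset.sum_div]
    refine tendsto_finsetSum _ fun r hr => ?_
    simpa only [Finset.sum_div] using h r (Finset.mem_range.1 hr)
  have hmod : Tendsto (fun N : ℕ => ((N % d : ℕ) : ℝ) / N) atTop (𝓝 0) :=
    hzero _ (fun N => Nat.cast_nonneg _) fun N => by exact_mod_cast (Nat.mod_lt N hd).le
  have hratio : Tendsto (fun N : ℕ => ((N / d : ℕ) : ℝ) / N) atTop (𝓝 (1 / d)) := by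
    have h2 : Tendsto (fun N : ℕ => (1 - ((N % d : ℕ) : ℝ) / N) / d) atTop (𝓝 ((1 - 0) / d)) :=
      (tendsto_const_nhds.sub hmod).div_const _
    rw [sub_zero] at h2
    refine h2.congr' ?_
    filter_upwards [eventually_gt_atTop 0] with N hN
    have hN' : (0 : ℝ) < N := by exact_mod_cast hN
    have e : (d : ℝ) * (N / d : ℕ) + (N % d : ℕ) = N := by exact_mod_cast Nat.div_add_mod N d
    field_simp
    linarith
  have hrest : Tendsto (fun N : ℕ => (∑ j ∈ Finset.range (N % d), g (d * (N / d) + j)) / N) atTop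
      (𝓝 0) := by
    refine hzero _ (fun N => Finset.sum_nonneg fun j _ => h0 _) fun N => ?_
    refine (Finset.sum_le_sum fun j _ => h1 _).trans ?_
    simpa using (Nat.mod_lt N hd).le
  have h3 := ((hblocks.comp hdiv).mul hratio).add hrest
  rw [add_zero, mul_one_div] at h3
  refine h3.congr' ?_
  filter_upwards [eventually_ge_atTop d] with N hN
  have hq : ((N / d : ℕ) : ℝ) ≠ 0 := by
    have := Nat.div_pos hN hd
    positivity
  simp only [Function.comp]
  rw [div_mul_div_cancel₀ hq, ← add_div, ← Finset.sum_range_add, Nat.div_add_mod]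

theorem sum_range_natCast_zmod {q : ℕ} [NeZero q] (f : ZMod q → ℝ) :
    ∑ i ∈ Finset.range q, f (i : ZMod q) = ∑ s, f s :=
  (Finset.sum_nbij' (s := Finset.univ) (t := Finset.range q) (fun s : ZMod q => s.val)
    (fun i : ℕ => (i : ZMod q)) (fun s _ => Finset.mem_range.2 (ZMod.val_lt s))
    (fun _ _ => Finset.mem_univ _) (fun s _ => ZMod.natCast_zmod_val s)
    (fun i hi => ZMod.val_cast_of_lt (Finset.mem_range.1 hi))
    fun s _ => by rw [ZMod.natCast_zmod_val]).symm

/-- The spacing `q * (l + 1)` is a multiple of `q`, which keeps the phase; it is at least `l`, which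
keeps windows disjoint; and it is positive even for `l = 0`. -/
theorem hasFrequencies_of_residues {x : BinSeq} {q : ℕ} [NeZero q] {θ : ZMod q → ℝ}
    (h : ∀ (l : ℕ) (u : Word l) (r : ℕ), Tendsto (fun M : ℕ => (∑ m ∈ Finset.range M,
      if window x l (r + q * (l + 1) * m) = u then (1 : ℝ) else 0) / M) atTop
      (𝓝 (phaseWeight θ (r : ZMod q) l u))) :
    HasFrequencies x (periodicWeight θ) := by
  intro l u
  have hq : (0 : ℝ) < q := by exact_mod_cast NeZero.pos q
  have h1 := tendsto_cesaro_of_residues (g := fun i => if window x l i = u then (1 : ℝ) else 0)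
    (fun i => by split_ifs <;> simp) (fun i => by split_ifs <;> simp)
    (Nat.mul_pos (NeZero.pos q) l.succ_pos) fun r _ => h l u r
  have e : (∑ r ∈ Finset.range (q * (l + 1)), phaseWeight θ (r : ZMod q) l u) /
      ((q * (l + 1) : ℕ) : ℝ) = periodicWeight θ l u := by
    rw [sum_range_mul_eq fun i => phaseWeight θ (i : ZMod q) l u, periodicWeight]
    simp only [Nat.cast_add, Nat.cast_mul, ZMod.natCast_self, zero_mul, add_zero, Finset.sum_const,
      Finset.card_range, nsmul_eq_mul, Nat.cast_one]
    rw [← Finset.mul_sum, sum_range_natCast_zmod fun s => phaseWeight θ s l u]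
    field_simp
  rw [e] at h1
  -- This factor is `(n + 1 - l) / n`: there are `n + 1 - l` window positions, while the frequency
  -- is normalised by `n`.
  have h2 : Tendsto (fun n : ℕ => 1 + (1 - (l : ℝ)) / n) atTop (𝓝 (1 + 0)) :=
    tendsto_const_nhds.add (tendsto_const_nhds.div_atTop tendsto_natCast_atTop_atTop)
  have hsub : Tendsto (fun n : ℕ => n + 1 - l) atTop atTop :=
    tendsto_atTop_mono (fun n => by omega) (tendsto_sub_atTop_nat l)
  have h3 := (h1.comp hsub).mul h2
  rw [add_zero, mul_one] at h3
  refine h3.congr' ?_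
  filter_upwards [eventually_gt_atTop l] with n hn
  have hn' : (0 : ℝ) < n := by exact_mod_cast (Nat.zero_le l).trans_lt hn
  have hln : (l : ℝ) ≤ n := by exact_mod_cast hn.le
  have hc : ((n + 1 - l : ℕ) : ℝ) = n + 1 - l := by
    rw [Nat.cast_sub (by omega)]
    push_cast
    ring
  have hc' : (0 : ℝ) < n + 1 - l := by linarith
  rw [occ_pre, count]
  simp only [Function.comp, hc]
  push_cast
  field_simp
  ring

-- The symbols are functions of points of a general space `A`, so that several sequences can be
-- built from the same random points.
open MeasureTheory ProbabilityTheory in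
theorem ae_hasFrequencies {A : Type*} [MeasurableSpace A] (ν : Measure A) [IsProbabilityMeasure ν]
    {q : ℕ} [NeZero q] {φ : ZMod q → A → Bool} (hφ : ∀ s, Measurable (φ s)) {θ : ZMod q → ℝ}
    (hθ : ∀ s, ν.real {a | φ s a = false} = θ s) :
    ∀ᵐ ω ∂Measure.infinitePi (fun _ : ℕ => ν),
      HasFrequencies (fun n => φ (n : ZMod q) (ω n)) (periodicWeight θ) := by
  set μ := Measure.infinitePi (fun _ : ℕ => ν)
  set X : ℕ → (ℕ → A) → Bool := fun n ω => φ (n : ZMod q) (ω n) with hXdef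
  have hX : ∀ n, Measurable (X n) := fun n => (hφ _).comp (measurable_pi_apply n)
  have hind : iIndepFun X μ := iIndepFun_infinitePi fun n => hφ (n : ZMod q)
  have hfalse : ∀ n, (μ.map (X n)).real {false} = θ n := by
    intro n
    have h1 : μ.map (X n) = ν.map (φ n) := by
      rw [← Measure.infinitePi_map_eval (fun _ : ℕ => ν) n,
        Measure.map_map (hφ _) (measurable_pi_apply n)]
      rfl
    rw [h1, map_measureReal_apply (hφ _) (measurableSet_singleton _), ← hθ]
    rfl
  have ht : ∀ n c, (μ.map (X n)).real {c} = symbolWeight (θ n) c := by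
    intro n c
    have := Measure.isProbabilityMeasure_map (μ := μ) (hX n).aemeasurable
    cases c
    · rw [hfalse, symbolWeight, if_pos rfl]
    · have h2 : ({true} : Set Bool) = {false}ᶜ := by
        ext b
        cases b <;> simp
      rw [h2, probReal_compl_eq_one_sub (measurableSet_singleton _), hfalse]
      simp [symbolWeight]
  have key : ∀ᵐ ω ∂μ, ∀ (l : ℕ) (u : Word l) (r : ℕ),
      Tendsto (fun M : ℕ => (∑ m ∈ Finset.range M,
        if window (fun n => X n ω) l (r + q * (l + 1) * m) = u then (1 : ℝ) else 0) / M) atTop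
        (𝓝 (phaseWeight θ (r : ZMod q) l u)) := by
    rw [ae_all_iff]
    intro l
    rw [ae_all_iff]
    intro u
    rw [ae_all_iff]
    intro r
    have hld : l ≤ q * (l + 1) := by nlinarith [NeZero.pos q]
    have := ae_tendsto_block_frequency hX hind (t := fun n : ℕ => θ (n : ZMod q)) ht
      (d := q * (l + 1)) (fun n m => by simp) hld u r
    simpa only [phaseWeight, Nat.cast_add] using this
  filter_upwards [key] with ω hω
  exact hasFrequencies_of_residues hω

/-! ### Bernoulli-generic sequences and interleavings -/

theorem periodicWeight_one (a : ℝ) (l : ℕ) (u : Word l) :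
    periodicWeight (fun _ : ZMod 1 => a) l u = ∏ j : Fin l, if u j = false then a else 1 - a := by
  simp [periodicWeight, phaseWeight, symbolWeight]

theorem bernoulliGeneric_iff {a : ℝ} {x : BinSeq} :
    BernoulliGeneric a x ↔ HasFrequencies x (periodicWeight fun _ : ZMod 1 => a) := by
  simp only [BernoulliGeneric, HasFrequencies, periodicWeight_one]

theorem BernoulliGeneric.borelNormal {x : BinSeq} (h : BernoulliGeneric (1 / 2) x) :
    BorelNormal x := by
  intro l u
  have h1 : (∏ j : Fin l, if u j = false then (1 / 2 : ℝ) else 1 - 1 / 2) = (1 / 2) ^ l := by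
    rw [Finset.prod_congr rfl fun j _ => (by norm_num :
      (if u j = false then (1 / 2 : ℝ) else 1 - 1 / 2) = 1 / 2)]
    simp
  rw [← h1]
  exact h l u

theorem BernoulliGeneric.limits {a : ℝ} (h0 : 0 ≤ a) (h1 : a ≤ 1 / 2) {x : BinSeq}
    (h : BernoulliGeneric a x) :
    gammaLower x = a ∧ gammaUpper x = a ∧ betaLower x = a ∧ betaUpper x = a ∧
      hLower x = shannonH a ∧ hUpper x = shannonH a := by
  have := (bernoulliGeneric_iff.1 h).limits fun _ => Or.inl ⟨h0, h1⟩
  simpa [min_eq_left (by linarith : a ≤ 1 - a)] using this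

/-- The symbol that is `0` below `b` and `1` from `b` on. -/
noncomputable def threshold (b : ℝ) (t : unitInterval) : Bool := decide (b ≤ (t : ℝ))

theorem measurable_threshold (b : ℝ) : Measurable (threshold b) := by
  refine measurable_to_bool ?_
  have : threshold b ⁻¹' {true} = {t : unitInterval | b ≤ (t : ℝ)} := by
    ext t
    simp [threshold]
  rw [this]
  exact measurableSet_le measurable_const measurable_subtype_coe

theorem volume_threshold_false {b : ℝ} (hb : b ∈ Set.Icc (0 : ℝ) 1) :
    MeasureTheory.volume.real {t | threshold b t = false} = b := by
  have : {t | threshold b t = false} = Set.Iio (⟨b, hb⟩ : unitInterval) := by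
    ext t
    simp [threshold, ← Subtype.coe_lt_coe]
  rw [this, MeasureTheory.Measure.real, unitInterval.volume_Iio, ENNReal.toReal_ofReal hb.1]

/-- The law of infinitely many independent uniform points of the unit interval. -/
noncomputable def uniformLaw : MeasureTheory.Measure (ℕ → unitInterval) :=
  MeasureTheory.Measure.infinitePi fun _ => MeasureTheory.volume

instance : MeasureTheory.IsProbabilityMeasure uniformLaw := by
  unfold uniformLaw
  infer_instance

theorem ae_bernoulliGeneric {b : ℝ} (hb : b ∈ Set.Icc (0 : ℝ) 1) :
    ∀ᵐ ω ∂uniformLaw, BernoulliGeneric b fun n => threshold b (ω n) := by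
  simp only [bernoulliGeneric_iff]
  exact ae_hasFrequencies MeasureTheory.volume (φ := fun _ => threshold b)
    (fun _ => measurable_threshold b) fun _ => volume_threshold_false hb

/-- The probabilities of `0` in the phases of an interleaving of a normal sequence, a sequence that
is generic for the Bernoulli measure of parameter `b`, and zeros. -/
noncomputable def interleaveParam (p : ℕ) {q : ℕ} (b : ℝ) (s : ZMod q) : ℝ :=
  if s.val < p then 1 / 2 else if s.val = p then b else 1

/-- The two interleaved sequences are dependent, but each position of the result uses only its own
uniform point, so the symbols of the result are independent. Genericity of the two sequences alone
would not determine the frequencies of their interleaving. -/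
theorem ae_interleave {p q : ℕ} [NeZero q] {b : ℝ} (hb : b ∈ Set.Icc (0 : ℝ) 1) :
    ∀ᵐ ω ∂uniformLaw, HasFrequencies
      (interleave p q (fun n => threshold (1 / 2) (ω n)) fun n => threshold b (ω n))
      (periodicWeight (interleaveParam p (q := q) b)) := by
  have h := ae_hasFrequencies MeasureTheory.volume (q := q)
    (φ := fun s t => if s.val < p then threshold (1 / 2) t
      else if s.val = p then threshold b t else false)
    (θ := interleaveParam p b) (fun s => ?_) (fun s => ?_)
  · unfold uniformLaw
    filter_upwards [h] with ω hω
    simp only [ZMod.val_natCast] at hω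
    exact hω
  · split_ifs
    · exact measurable_threshold _
    · exact measurable_threshold _
    · exact measurable_const
  · unfold interleaveParam
    split_ifs
    · exact volume_threshold_false (by norm_num)
    · exact volume_threshold_false hb
    · simp

theorem sum_interleaveParam {p q : ℕ} [NeZero q] (hpq : p < q) (b : ℝ) {F : ℝ → ℝ} (hF : F 1 = 0) :
    ∑ s : ZMod q, F (interleaveParam p b s) = p * F (1 / 2) + F b := by
  rw [← sum_range_natCast_zmod]
  obtain ⟨k, hk⟩ := Nat.exists_eq_add_of_lt hpq
  have h1 : ∀ i ∈ Finset.range q, F (interleaveParam p b (i : ZMod q)) =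
      if i < p then F (1 / 2) else if i = p then F b else 0 := by
    intro i hi
    rw [interleaveParam, ZMod.val_cast_of_lt (Finset.mem_range.1 hi)]
    split_ifs
    · rfl
    · rfl
    · exact hF
  have h2 : ∑ i ∈ Finset.range p, (if i < p then F (1 / 2) else if i = p then F b else 0) =
      p * F (1 / 2) := by
    rw [Finset.sum_congr rfl fun i hi => if_pos (Finset.mem_range.1 hi)]
    simp
  have h3 : ∑ i ∈ Finset.range k,
      (if p + 1 + i < p then F (1 / 2) else if p + 1 + i = p then F b else 0) = 0 :=
    Finset.sum_eq_zero fun i _ => by rw [if_neg (by omega), if_neg (by omega)]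
  rw [Finset.sum_congr rfl h1, show q = p + 1 + k by omega, Finset.sum_range_add,
    Finset.sum_range_succ, h2, h3]
  simp

theorem HasFrequencies.interleave_limits {p q : ℕ} [NeZero q] (hpq : p < q) {b : ℝ} (h0 : 0 ≤ b)
    (h1 : b ≤ 1 / 2) {x : BinSeq}
    (h : HasFrequencies x (periodicWeight (interleaveParam p (q := q) b))) :
    gammaLower x = p / (2 * q) + b / q ∧ gammaUpper x = p / (2 * q) + b / q ∧
      betaLower x = p / (2 * q) + b / q ∧ betaUpper x = p / (2 * q) + b / q ∧
      hLower x = p / q + shannonH b / q ∧ hUpper x = p / q + shannonH b / q := by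
  have hθ : ∀ s : ZMod q, interleaveParam p b s ∈ Set.Icc (0 : ℝ) (1 / 2) ∨
      interleaveParam p b s = 1 := by
    intro s
    unfold interleaveParam
    split_ifs
    · exact Or.inl (by norm_num)
    · exact Or.inl ⟨h0, h1⟩
    · exact Or.inr rfl
  have hl := h.limits hθ
  have hhalf : shannonH (1 / 2) = 1 := by
    rw [shannonH_eq, one_div, Real.binEntropy_two_inv, div_self (Real.log_pos one_lt_two).ne']
  rw [sum_interleaveParam hpq b (F := fun t => min t (1 - t)) (by norm_num),
    sum_interleaveParam hpq b (F := shannonH) (by simp [shannonH_eq]), hhalf,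
    min_eq_left (by linarith : b ≤ 1 - b), min_eq_left (by norm_num : (1 / 2 : ℝ) ≤ 1 - 1 / 2)] at hl
  have e1 : ((p : ℝ) * (1 / 2) + b) / q = p / (2 * q) + b / q := by
    field_simp
  have e2 : ((p : ℝ) * 1 + shannonH b) / q = p / q + shannonH b / q := by
    rw [mul_one, add_div]
  rwa [e1, e2] at hl

theorem exists_interleave_parameters {a : ℝ} (h0 : 0 ≤ a) (h1 : a ≤ 1 / 2) {q : ℕ} (hq : 0 < q) :
    ∃ (p : ℕ) (b : ℝ), p < q ∧ 0 ≤ b ∧ b ≤ 1 / 2 ∧ a = p / (2 * q) + b / q := by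
  have hq' : (0 : ℝ) < q := by exact_mod_cast hq
  have hfl := Nat.floor_le (by positivity : 0 ≤ 2 * q * a)
  have hlt := Nat.lt_floor_add_one (2 * q * a)
  -- The cap `q - 1` matters only for `a = 1/2`, where the floor is `q`; the remainder is then
  -- exactly `1/2`.
  refine ⟨min ⌊2 * q * a⌋₊ (q - 1), q * a - (min ⌊2 * q * a⌋₊ (q - 1) : ℕ) / 2, by omega, ?_, ?_, ?_⟩
  · have : ((min ⌊2 * q * a⌋₊ (q - 1) : ℕ) : ℝ) ≤ ⌊2 * q * a⌋₊ := by
      exact_mod_cast min_le_left _ _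
    linarith
  · rcases min_choice ⌊2 * q * a⌋₊ (q - 1) with h | h
    · rw [h]
      linarith
    · rw [h, Nat.cast_sub hq]
      push_cast
      nlinarith
  · field_simp
    ring

end RauzyEntropy

theorem theorem1 :
    -- the limits that define the six quantities exist, and the bounds hold
    (∀ x : BinSeq,
      (Tendsto (fun l : ℕ => gammaLowerAt l x) atTop (𝓝 (gammaLower x)) ∧
        Tendsto (fun l : ℕ => gammaUpperAt l x) atTop (𝓝 (gammaUpper x)) ∧
        Tendsto (fun l : ℕ => betaLowerAt l x) atTop (𝓝 (betaLower x)) ∧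
        Tendsto (fun l : ℕ => betaUpperAt l x) atTop (𝓝 (betaUpper x)) ∧
        Tendsto (fun l : ℕ => hLowerAt l x) atTop (𝓝 (hLower x)) ∧
        Tendsto (fun l : ℕ => hUpperAt l x) atTop (𝓝 (hUpper x))) ∧
      (2 * gammaLower x ≤ hLower x ∧ hLower x ≤ shannonH (gammaLower x)) ∧
      (2 * gammaUpper x ≤ hUpper x ∧ hUpper x ≤ shannonH (gammaUpper x)) ∧
      (2 * betaLower x ≤ hLower x ∧ hLower x ≤ shannonH (betaLower x)) ∧
      (2 * betaUpper x ≤ hUpper x ∧ hUpper x ≤ shannonH (betaUpper x))) ∧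
    -- the bounds are sharp
    (∀ a : ℝ, 0 ≤ a → a ≤ 1 / 2 →
      -- upper bounds: Bernoulli-generic sequences
      (∃ x : BinSeq, BernoulliGeneric a x) ∧
      (∀ x : BinSeq, BernoulliGeneric a x →
        gammaLower x = a ∧ gammaUpper x = a ∧ betaLower x = a ∧ betaUpper x = a ∧
        hLower x = shannonH a ∧ hUpper x = shannonH a) ∧
      -- lower bounds: interleavings of a normal sequence, a Bernoulli-generic one and zeros
      (∀ ε : ℝ, 0 < ε →
        ∃ (p q : ℕ) (b : ℝ) (y z x : BinSeq),
          p < q ∧ 0 ≤ b ∧ b ≤ 1 / 2 ∧ a = p / (2 * q) + b / q ∧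
          BorelNormal y ∧ BernoulliGeneric b z ∧ x = interleave p q y z ∧
          gammaLower x = a ∧ gammaUpper x = a ∧ betaLower x = a ∧ betaUpper x = a ∧
          hLower x = p / q + shannonH b / q ∧ hUpper x = p / q + shannonH b / q ∧
          p / q + shannonH b / q ≤ 2 * a + ε)) := by
  refine ⟨rauzy_bounds, fun a h0 h1 => ⟨?_, fun x hx => hx.limits h0 h1, fun ε hε => ?_⟩⟩
  · obtain ⟨ω, hω⟩ := (ae_bernoulliGeneric ⟨h0, h1.trans (by norm_num)⟩).exists
    exact ⟨_, hω⟩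
  -- With `q = n + 1` the rate exceeds `2 * a` by at most `H b / q ≤ 1 / q < ε`.
  · obtain ⟨n, hn⟩ := exists_nat_one_div_lt hε
    obtain ⟨p, b, hpq, hb0, hb1, hab⟩ := exists_interleave_parameters h0 h1 n.succ_pos
    have hb : b ∈ Set.Icc (0 : ℝ) 1 := ⟨hb0, hb1.trans (by norm_num)⟩
    -- Three almost sure events of the same law hold at a common point, which yields `y`, `z` and
    -- their interleaving together.
    obtain ⟨ω, ⟨hy, hz⟩, hx⟩ := (((ae_bernoulliGeneric (b := 1 / 2) (by norm_num)).and
      (ae_bernoulliGeneric hb)).and (ae_interleave (p := p) (q := n + 1) hb)).exists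
    obtain ⟨g1, g2, g3, g4, e1, e2⟩ := hx.interleave_limits hpq hb0 hb1
    refine ⟨p, n + 1, b, _, _, _, hpq, hb0, hb1, hab, hy.borelNormal, hz, rfl, hab ▸ g1, hab ▸ g2,
      hab ▸ g3, hab ▸ g4, e1, e2, ?_⟩
    have hH : shannonH b ≤ 1 := by
      rw [shannonH_eq]
      exact div_le_one_of_le₀ Real.binEntropy_le_log_two (Real.log_nonneg one_le_two)
    have hq : (0 : ℝ) < (n + 1 : ℕ) := by positivity
    have h2 : (p : ℝ) / (n + 1 : ℕ) ≤ 2 * a := by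
      have h3 : 2 * ((p : ℝ) / (2 * (n + 1 : ℕ))) = p / (n + 1 : ℕ) := by field_simp
      have := div_nonneg hb0 hq.le
      rw [hab]
      simp only [Nat.succ_eq_add_one]
      linarith
    have h4 : shannonH b / (n + 1 : ℕ) ≤ 1 / ((n : ℝ) + 1) := by
      push_cast
      exact div_le_div_of_nonneg_right hH (by positivity)
    linarith
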